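/- An asset has to be sold within a marketing period of length $t\ge 0$. Offers arrive after independent waiting times $D_1,D_2,\dots$, exponentially distributed with rate $\lambda>0$, so that the time remaining until the deadline at the $i$-th offer is $t_i=(t_{i-1}-D_i)_+$, with $t_0=t$. The offers $X_1,X_2,\dots$ are independent copies of a random variable $X$ with distribution function $F$, and if no offer is accepted at a time with $t_i>0$, the asset is sold at a residual price $X_0$; the random variables $D_i$, $X_i$ ($i\ge1$) and $X_0$ are mutually independent. Offers cannot be recalled. A policy is a (measurable) rule that decides on the acceptance of an offer depending on its value and on the remaining time. Let $\mu(s)$ denote the maximal expected sale price over all policies (with integrable sale price) when the marketing period is $s$, and let $S_t$ be the sale price under the optimal policy, which accepts an offer $x$ at remaining time $s>0$ if and only if $x\ge\mu(s)$. Put $\mu_0=E[X_0]$, $M=\sup\{x: F(x)<1\}\in(-\infty,\infty]$ and $\phi(x)=\int_x^\infty(1-F(u))\,du$, and assume $0\le\mu_0<M$. **Theorem.** Assume $E[X_0^2]<\infty$ and $E[X_+^2]<\infty$, where $X_+=\max(X,0)$. Then, for every $t\ge0$, the above policy is optimal, with $E[S_t]=\mu(t)\ge\mu_0$; the variance of $S_t$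 is finite; $\phi(w)=E[(X-w)_+]$ is positive and finite for $\mu_0\le w\le\mu(t)$, all the integrals below converge, and $$\mathrm{Var}[S_t]=\phi(\mu(t))\left[\frac{\mathrm{Var}[X_0]}{\phi(\mu_0)}+2\int_{\mu_0}^{\mu(t)}\frac{1}{\phi(w)^2}\int_w^\infty\phi(x)\,dx\,dw\right],$$ which can also be written as $$\mathrm{Var}[S_t]=E[(X-\mu(t))_+]\left[\mu(t)-\mu_0+\frac{\mathrm{Var}[X_0]}{E[(X-\mu_0)_+]}+\int_{\mu_0}^{\mu(t)}\frac{\mathrm{Var}[(X-w)_+]}{E[(X-w)_+]^2}\,dw\right].$$ -/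

import Mathlib

open MeasureTheory ProbabilityTheory Set

noncomputable section

/-- The times `t_0 = t`, `t_{i+1} = (t_i - D_{i+1})_+` that remain until the deadline. The waiting
times are numbered from `0`, so that `d i` is the waiting time between the `i`-th and the
`(i+1)`-st offer, and the offer `x i` arrives when the remaining time is `timeLeft d t (i + 1)`. -/
def timeLeft (d : ℕ → ℝ) (t : ℝ) : ℕ → ℝ
  | 0 => t
  | i + 1 => max (timeLeft d t i - d i) 0

/-- A policy is a rule that decides whether an offer is accepted, depending on the remaining time
and on the value of the offer: it is given by the set `A` of the pairs (remaining time, offer) that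
are accepted. `Accepts A d x t i` says that the policy is ready to take the offer `x i` and that
this offer arrives before the deadline. -/
def Accepts (A : Set (ℝ × ℝ)) (d x : ℕ → ℝ) (t : ℝ) (i : ℕ) : Prop :=
  0 < timeLeft d t (i + 1) ∧ (timeLeft d t (i + 1), x i) ∈ A

open Classical in
/-- The realized sale price with marketing period `t` under the policy `A`: the first offer that is
accepted before the deadline, or the residual price `x₀` if there is none. -/
def salePrice (A : Set (ℝ × ℝ)) (d x : ℕ → ℝ) (x₀ t : ℝ) : ℝ :=
  if h : ∃ i, Accepts A d x t i then x (Nat.find h) else x₀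

/-- The bidding process: the waiting times `D i` are exponentially distributed with rate `lam`, the
offers `X i` have law `ν`, the residual price `X₀` has law `ν₀`, and all of these random variables
are mutually independent. -/
structure IsBiddingProcess {Ω : Type*} [MeasurableSpace Ω] (P : Measure Ω) (lam : ℝ)
    (ν ν₀ : Measure ℝ) (D X : ℕ → Ω → ℝ) (X₀ : Ω → ℝ) : Prop where
  hasLaw_wait : ∀ i, HasLaw (D i) (expMeasure lam) P
  hasLaw_offer : ∀ i, HasLaw (X i) ν P
  hasLaw_residual : HasLaw X₀ ν₀ P
  indep : iIndepFun (Sum.elim D (Sum.elim X (fun _ : Unit => X₀))) P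

/-- The expected sale prices, with marketing period `t`, of all (measurable) policies for which the
sale price is integrable. -/
def expectedPrices {Ω : Type*} [MeasurableSpace Ω] (P : Measure Ω) (D X : ℕ → Ω → ℝ) (X₀ : Ω → ℝ)
    (t : ℝ) : Set ℝ :=
  {v | ∃ A : Set (ℝ × ℝ), MeasurableSet A ∧
    Integrable (fun ω => salePrice A (D · ω) (X · ω) (X₀ ω) t) P ∧
    v = ∫ ω, salePrice A (D · ω) (X · ω) (X₀ ω) t ∂P}

/-- `μ(t)`: the maximal expected sale price that can be achieved when no offer is at hand and the
time `t` remains until the deadline. -/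
def optimalValue {Ω : Type*} [MeasurableSpace Ω] (P : Measure Ω) (D X : ℕ → Ω → ℝ) (X₀ : Ω → ℝ)
    (t : ℝ) : ℝ :=
  sSup (expectedPrices P D X X₀ t)

/-- The optimal policy: an offer `x` is accepted at remaining time `s` if and only if
`x ≥ μ(s)`. -/
def optimalPolicy {Ω : Type*} [MeasurableSpace Ω] (P : Measure Ω) (D X : ℕ → Ω → ℝ) (X₀ : Ω → ℝ) :
    Set (ℝ × ℝ) :=
  {p | optimalValue P D X X₀ p.1 ≤ p.2}

/-- `S_t`: the realized sale price with marketing period `t` under the optimal policy. -/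
def optimalPrice {Ω : Type*} [MeasurableSpace Ω] (P : Measure Ω) (D X : ℕ → Ω → ℝ) (X₀ : Ω → ℝ)
    (t : ℝ) (ω : Ω) : ℝ :=
  salePrice (optimalPolicy P D X X₀) (D · ω) (X · ω) (X₀ ω) t

/-- `M = sup {x | F(x) < 1}`, where `F` is the distribution function of `ν`. -/
def supportSup (ν : Measure ℝ) : EReal :=
  sSup ((fun x : ℝ => (x : EReal)) '' {x : ℝ | cdf ν x < 1})

/-- `φ(x) = ∫_x^∞ (1 - F(u)) du`, where `F` is the distribution function of `ν`. -/
def tailIntegral (ν : Measure ℝ) (x : ℝ) : ℝ :=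
  ∫ u in Ioi x, (1 - cdf ν u)

end

/-!
Let `φ(w) = E[(X - w)₊]`, the tail integral of the offer distribution. The reservation price solves
`m' = lam * φ(m)` with `m 0 = E[X₀]`. As `φ` is nonincreasing, 1-Lipschitz and tends to `0`, the
solution is global and never reaches the zeros of `φ` (`exists_hasDerivAt_eq_mul_comp`).

Expectations of sale prices are computed by a verification argument instead of by conditioning on
the first offer. For a payoff function `f` and a candidate `G` for the expected payoff as a function
of the remaining time, stop the process after `n` offers and pay `G` of the time that is left. If
`G` does not increase on average over one arrival, these truncated payoffs form a supermartingale,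
and since the probability that time is left after `n` arrivals decays geometrically, the expected
payoff is at most `G t` (`integral_payoff_le`). For exponential waiting times the average over one
arrival is governed by the differential equation `G' = lam * (K - G)`, where `K u` is the mean
payoff of an offer that arrives at the remaining time `u`
(`integral_expMeasure_eq_of_hasDerivAt`, `integral_payoff_eq`).

This is applied three times in `thresholdPolicy_moments`. With `f x = x` and `G = m` it shows that
no policy has an expected price above `m t`, and that the policy with the threshold `m` attains it;
hence `m` is the optimal value. With `f x = x ^ 2` and `G = V + m ^ 2` it gives the variance `V`,
which solves the linear equation `V' = lam * (E[((X - m)₊) ^ 2] - P(X ≥ m) * V)`. Written in terms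
of the level `w = m s` its solution is `priceVariance`, the first formula of the theorem. The slope
`-P(X ≥ w)` of `φ` exists except at the countably many atoms of the offer distribution, and `m`
visits each of them only once, so the fundamental theorem of calculus off a countable set applies.
The second formula follows from `2 * ∫_w^∞ φ = E[((X - w)₊) ^ 2]`
(`integrableOn_integral_max_sub`).
-/

/-! ### The tail integral of the offer distribution -/

lemma integrable_max_sub {ν : Measure ℝ} [IsFiniteMeasure ν]
    (h : Integrable (fun x : ℝ => max x 0) ν) (w : ℝ) :
    Integrable (fun x : ℝ => max (x - w) 0) ν := by
  refine (h.add (integrable_const |w|)).mono' (by fun_prop) (.of_forall fun x => ?_)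
  have h1 := neg_abs_le w
  have h2 := abs_nonneg w
  rw [Real.norm_of_nonneg (le_max_right _ _)]
  simp only [Pi.add_apply]
  rcases max_cases x 0 with h | h <;> rcases max_cases (x - w) 0 with h' | h' <;> linarith

lemma integrableOn_integral_and_eq_of_tonelli {ν : Measure ℝ} [SFinite ν] {k : ℝ → ℝ → ℝ}
    (hk : Measurable (Function.uncurry k)) (h0 : ∀ u y, 0 ≤ k u y) {w : ℝ} {g : ℝ → ℝ}
    (hi : ∀ y, IntegrableOn (fun u => k u y) (Ioi w)) (hg : ∀ y, ∫ u in Ioi w, k u y = g y)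
    (hgi : Integrable g ν) :
    IntegrableOn (fun u => ∫ y, k u y ∂ν) (Ioi w) ∧
      ∫ u in Ioi w, ∫ y, k u y ∂ν = ∫ y, g y ∂ν := by
  have hint : Integrable (Function.uncurry k) ((volume.restrict (Ioi w)).prod ν) := by
    rw [integrable_prod_iff' hk.aestronglyMeasurable]
    refine ⟨.of_forall hi, hgi.congr (.of_forall fun y => ?_)⟩
    simp [Function.uncurry, abs_of_nonneg (h0 _ _), hg]
  refine ⟨hint.integral_prod_left, ?_⟩
  rw [integral_integral_swap hint]
  simp [hg]

lemma setIntegral_Ioi_indicator_Iio (w y : ℝ) :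
    IntegrableOn ((Iio y).indicator (fun _ => (1 : ℝ))) (Ioi w) ∧
      ∫ u in Ioi w, (Iio y).indicator (fun _ => (1 : ℝ)) u = max (y - w) 0 := by
  have e : Iio y ∩ Ioi w = Ioo w y := by ext; simp [and_comm]
  constructor
  · rw [IntegrableOn, integrable_indicator_iff measurableSet_Iio, IntegrableOn,
      Measure.restrict_restrict measurableSet_Iio, e]
    simp
  · rw [integral_indicator measurableSet_Iio, Measure.restrict_restrict measurableSet_Iio, e]
    simp [Measure.real, ENNReal.toReal_ofReal']

lemma setIntegral_Ioi_max_sub (w y : ℝ) :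
    IntegrableOn (fun u => max (y - u) 0) (Ioi w) ∧
      ∫ u in Ioi w, max (y - u) 0 = (max (y - w) 0) ^ 2 / 2 := by
  have hz : ∀ u ∈ Ioi w \ Ioc w y, max (y - u) 0 = 0 := by
    intro u hu
    simp only [mem_sdiff, mem_Ioi, mem_Ioc, not_and, not_le] at hu
    exact max_eq_right (by linarith [hu.2 hu.1])
  have hi : IntegrableOn (fun u => max (y - u) 0) (Ioc w y) :=
    ((by fun_prop : Continuous fun u => max (y - u) 0).integrableOn_Icc).mono_set Ioc_subset_Icc_self
  constructor
  · exact hi.of_forall_sdiff_eq_zero measurableSet_Ioi hz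
  · rw [setIntegral_eq_of_subset_of_forall_sdiff_eq_zero measurableSet_Ioi Ioc_subset_Ioi_self hz]
    rcases le_total w y with h | h
    · rw [← intervalIntegral.integral_of_le h, max_eq_left (by linarith)]
      have : ∫ u in w..y, max (y - u) 0 = ∫ u in w..y, (y - u) := by
        refine intervalIntegral.integral_congr fun u hu => ?_
        rw [uIcc_of_le h] at hu
        exact max_eq_left (by linarith [hu.2])
      rw [this, intervalIntegral.integral_comp_sub_left (fun x => x)]
      simp
    · simp [h]

lemma one_sub_cdf_eq_integral (ν : Measure ℝ) [IsProbabilityMeasure ν] (u : ℝ) :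
    1 - cdf ν u = ∫ y, (Iio y).indicator (fun _ => (1 : ℝ)) u ∂ν := by
  have : (fun y => (Iio y).indicator (fun _ => (1 : ℝ)) u) = (Ioi u).indicator (fun _ => 1) := by
    ext y; simp [indicator]
  rw [this, integral_indicator measurableSet_Ioi, cdf_eq_real,
    ← probReal_compl_eq_one_sub measurableSet_Iic, compl_Iic]
  simp

lemma integrableOn_one_sub_cdf {ν : Measure ℝ} [IsProbabilityMeasure ν]
    (h : Integrable (fun x : ℝ => max x 0) ν) (w : ℝ) :
    IntegrableOn (fun u => 1 - cdf ν u) (Ioi w) ∧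
      tailIntegral ν w = ∫ x, max (x - w) 0 ∂ν := by
  have hk : Measurable (Function.uncurry fun u y : ℝ => (Iio y).indicator (fun _ => (1 : ℝ)) u) := by
    have : (Function.uncurry fun u y : ℝ => (Iio y).indicator (fun _ => (1 : ℝ)) u) =
        {p : ℝ × ℝ | p.1 < p.2}.indicator (fun _ => 1) := by
      ext p; simp [indicator, Function.uncurry]
    rw [this]
    exact measurable_const.indicator (measurableSet_lt measurable_fst measurable_snd)
  have := integrableOn_integral_and_eq_of_tonelli (ν := ν) hk
    (fun u y => indicator_nonneg (fun _ _ => zero_le_one) _)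
    (fun y => (setIntegral_Ioi_indicator_Iio w y).1)
    (fun y => (setIntegral_Ioi_indicator_Iio w y).2) (integrable_max_sub h w)
  simp_rw [← one_sub_cdf_eq_integral] at this
  exact this

lemma integrable_sq_max_sub {ν : Measure ℝ} [IsFiniteMeasure ν]
    (h : Integrable (fun x : ℝ => (max x 0) ^ 2) ν) (w : ℝ) :
    Integrable (fun x : ℝ => (max (x - w) 0) ^ 2) ν := by
  refine ((h.const_mul 2).add (integrable_const (2 * |w| ^ 2))).mono' (by fun_prop)
    (.of_forall fun x => ?_)
  rw [Real.norm_of_nonneg (by positivity)]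
  simp only [Pi.add_apply]
  have h1 := neg_abs_le w
  have h2 := abs_nonneg w
  have h3 : max (x - w) 0 ≤ max x 0 + |w| := by
    rcases max_cases x 0 with h | h <;> rcases max_cases (x - w) 0 with h' | h' <;> linarith
  nlinarith [le_max_right (x - w) 0, sq_nonneg (max x 0 - |w|)]

lemma integrable_max_of_sq {ν : Measure ℝ} [IsFiniteMeasure ν]
    (h : Integrable (fun x : ℝ => (max x 0) ^ 2) ν) : Integrable (fun x : ℝ => max x 0) ν :=
  (memLp_two_iff_integrable_sq (by fun_prop)).2 h |>.integrable (by norm_num)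

/-- The stop-loss transform `w ↦ E[(X - w)₊]` integrates to half the second moment of
`(X - w)₊`. -/
lemma integrableOn_integral_max_sub {ν : Measure ℝ} [IsProbabilityMeasure ν]
    (h : Integrable (fun x : ℝ => (max x 0) ^ 2) ν) (w : ℝ) :
    IntegrableOn (tailIntegral ν) (Ioi w) ∧
      ∫ x in Ioi w, tailIntegral ν x = (∫ x, (max (x - w) 0) ^ 2 ∂ν) / 2 := by
  have := integrableOn_integral_and_eq_of_tonelli (ν := ν)
    (k := fun u y => max (y - u) 0) (by fun_prop) (fun u y => le_max_right _ _)
    (fun y => (setIntegral_Ioi_max_sub w y).1)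
    (fun y => (setIntegral_Ioi_max_sub w y).2) ((integrable_sq_max_sub h w).div_const 2)
  simp_rw [← (integrableOn_one_sub_cdf (integrable_max_of_sq h) _).2, integral_div] at this
  exact this

lemma tailIntegral_sub_tailIntegral {ν : Measure ℝ} [IsProbabilityMeasure ν]
    (h : Integrable (fun x : ℝ => max x 0) ν) (a b : ℝ) :
    tailIntegral ν a - tailIntegral ν b = ∫ u in a..b, (1 - cdf ν u) :=
  intervalIntegral.integral_Ioi_sub_Ioi' (integrableOn_one_sub_cdf h a).1
    (integrableOn_one_sub_cdf h b).1

lemma antitone_tailIntegral {ν : Measure ℝ} [IsProbabilityMeasure ν]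
    (h : Integrable (fun x : ℝ => max x 0) ν) : Antitone (tailIntegral ν) := by
  intro a b hab
  rw [← sub_nonneg, tailIntegral_sub_tailIntegral h]
  exact intervalIntegral.integral_nonneg hab fun u _ => sub_nonneg.2 (cdf_le_one ν u)

lemma intervalIntegrable_one_sub_cdf (ν : Measure ℝ) (a b : ℝ) :
    IntervalIntegrable (fun u => 1 - cdf ν u) volume a b :=
  intervalIntegrable_const.sub (monotone_cdf ν).intervalIntegrable

lemma tailIntegral_sub_le {ν : Measure ℝ} [IsProbabilityMeasure ν]
    (h : Integrable (fun x : ℝ => max x 0) ν) {a b : ℝ} (hab : a ≤ b) :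
    tailIntegral ν a - tailIntegral ν b ≤ b - a := by
  rw [tailIntegral_sub_tailIntegral h]
  calc ∫ u in a..b, (1 - cdf ν u) ≤ ∫ u in a..b, (1 : ℝ) :=
        intervalIntegral.integral_mono_on hab (intervalIntegrable_one_sub_cdf ν a b)
          intervalIntegrable_const fun u _ => by linarith [cdf_nonneg ν u]
    _ = b - a := by simp

lemma continuous_tailIntegral {ν : Measure ℝ} [IsProbabilityMeasure ν]
    (h : Integrable (fun x : ℝ => max x 0) ν) : Continuous (tailIntegral ν) := by
  have : tailIntegral ν = fun w => tailIntegral ν 0 - ∫ u in (0 : ℝ)..w, (1 - cdf ν u) := by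
    ext w
    linarith [tailIntegral_sub_tailIntegral h 0 w]
  rw [this]
  exact continuous_const.sub
    (intervalIntegral.continuous_primitive (intervalIntegrable_one_sub_cdf ν) 0)

lemma hasDerivAt_tailIntegral {ν : Measure ℝ} [IsProbabilityMeasure ν]
    (h : Integrable (fun x : ℝ => max x 0) ν) {w : ℝ} (hw : ContinuousAt (cdf ν) w) :
    HasDerivAt (tailIntegral ν) (-(1 - cdf ν w)) w := by
  have : tailIntegral ν = fun w => tailIntegral ν 0 - ∫ u in (0 : ℝ)..w, (1 - cdf ν u) := by
    ext w
    linarith [tailIntegral_sub_tailIntegral h 0 w]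
  rw [this]
  refine HasDerivAt.const_sub _ (intervalIntegral.integral_hasDerivAt_right
    (intervalIntegrable_one_sub_cdf ν 0 w) ?_ (continuousAt_const.sub hw))
  exact ((measurable_const.sub
    (monotone_cdf ν).measurable).stronglyMeasurable.stronglyMeasurableAtFilter)

lemma tendsto_tailIntegral_atTop {ν : Measure ℝ} [IsProbabilityMeasure ν]
    (h : Integrable (fun x : ℝ => max x 0) ν) :
    Filter.Tendsto (tailIntegral ν) Filter.atTop (nhds 0) := by
  have h1 := intervalIntegral_tendsto_integral_Ioi 0 (integrableOn_one_sub_cdf h 0).1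
    Filter.tendsto_id
  have h2 := h1.const_sub (tailIntegral ν 0)
  rw [tailIntegral, sub_self] at h2
  refine h2.congr fun w => ?_
  have := tailIntegral_sub_tailIntegral h 0 w
  simp only [tailIntegral, id] at this ⊢
  linarith

lemma tailIntegral_pos_of_lt_supportSup {ν : Measure ℝ} [IsProbabilityMeasure ν]
    (h : Integrable (fun x : ℝ => max x 0) ν) {w : ℝ} (hw : (w : EReal) < supportSup ν) :
    0 < tailIntegral ν w := by
  obtain ⟨_, ⟨x, hx, rfl⟩, hwx⟩ := lt_sSup_iff.1 hw
  replace hwx : w < x := EReal.coe_lt_coe_iff.1 hwx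
  have h1 : (x - w) * (1 - cdf ν x) ≤ ∫ u in w..x, (1 - cdf ν u) := by
    calc (x - w) * (1 - cdf ν x) = ∫ u in w..x, (1 - cdf ν x) := by
          rw [intervalIntegral.integral_const, smul_eq_mul]
      _ ≤ _ := intervalIntegral.integral_mono_on hwx.le intervalIntegrable_const
        (intervalIntegrable_one_sub_cdf ν w x) fun u hu => by
          linarith [monotone_cdf ν hu.2]
  have h2 : 0 ≤ tailIntegral ν x :=
    integral_nonneg fun u => sub_nonneg.2 (cdf_le_one ν u)
  have h3 : 0 < (x - w) * (1 - cdf ν x) := mul_pos (sub_pos.2 hwx) (sub_pos.2 hx)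
  linarith [tailIntegral_sub_tailIntegral h w x]

lemma measureReal_Ici_eq_of_continuousAt_cdf {ν : Measure ℝ} [IsProbabilityMeasure ν] {w : ℝ}
    (hw : ContinuousAt (cdf ν) w) : ν.real (Ici w) = 1 - cdf ν w := by
  have h1 : ν {w} = 0 := by
    rw [← measure_cdf (μ := ν), StieltjesFunction.measure_singleton,
      hw.continuousWithinAt.leftLim_eq]
    simp
  have h2 : ν (Ici w) = ν (Ioi w) := by
    rw [← Ioi_union_left]
    refine le_antisymm ((measure_union_le _ _).trans (by simp [h1])) (measure_mono (by simp))
  rw [Measure.real, h2, ← Measure.real, ← compl_Iic, probReal_compl_eq_one_sub measurableSet_Iic,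
    cdf_eq_real]

/-! ### The autonomous equation for the reservation price -/

/-- Global solvability of `m' = lam * ψ(m)`, `m 0 = a`, for a nonincreasing `ψ` with slopes at
least `-1` that tends to `0`. The solution inverts `w ↦ ∫_a^w du / ψ(u)`; this integral diverges
as `ψ` runs down to `0` because it grows by at least `1 / 2` whenever `ψ` is halved. Left of `a`
the function `ψ` is frozen at `ψ a`, so that `m` is defined on the whole line. -/
lemma exists_hasDerivAt_eq_mul_comp {ψ : ℝ → ℝ} (hc : Continuous ψ) (ha : Antitone ψ)
    (hs : ∀ x y, x ≤ y → ψ x - ψ y ≤ y - x) (ht : Filter.Tendsto ψ Filter.atTop (nhds 0))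
    {a lam : ℝ} (hpos : 0 < ψ a) (hlam : 0 < lam) :
    ∃ m : ℝ → ℝ, StrictMono m ∧ Continuous m ∧ m 0 = a ∧ (∀ s, 0 < ψ (m s)) ∧
      ∀ s, 0 < s → HasDerivAt m (lam * ψ (m s)) s := by
  set p : ℝ → ℝ := fun w => ψ (max w a) with hp
  have pc : Continuous p := by fun_prop
  have pa : Antitone p := fun x y hxy => ha (max_le_max_right a hxy)
  have ple : ∀ w, p w ≤ ψ a := fun w => ha (le_max_right w a)
  set H : ℝ → ℝ := fun w => ∫ u in a..w, (p u)⁻¹ with hH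
  have hpa : p a = ψ a := by simp [hp]
  have cont : ∀ {x y}, x ≤ y → 0 < p y → ContinuousOn (fun u => (p u)⁻¹) (Icc x y) :=
    fun {x y} hxy hy => pc.continuousOn.inv₀ fun u hu => (hy.trans_le (pa hu.2)).ne'
  have ii : ∀ {x y}, 0 < p x → 0 < p y → IntervalIntegrable (fun u => (p u)⁻¹) volume x y := by
    intro x y hx hy
    rcases le_total x y with h | h
    · exact (cont h hy).intervalIntegrable_of_Icc h
    · exact ((cont h hx).intervalIntegrable_of_Icc h).symm
  have p0 : 0 < p a := hpa ▸ hpos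
  have Hsub : ∀ {x y}, x ≤ y → 0 < p y → (y - x) / p x ≤ H y - H x := by
    intro x y hxy hy
    have hx : 0 < p x := hy.trans_le (pa hxy)
    rw [hH, intervalIntegral.integral_interval_sub_left (ii p0 hy) (ii p0 hx)]
    calc (y - x) / p x = ∫ _ in x..y, (p x)⁻¹ := by
          rw [intervalIntegral.integral_const, smul_eq_mul, div_eq_mul_inv]
      _ ≤ _ := intervalIntegral.integral_mono_on hxy intervalIntegrable_const (ii hx hy)
          fun u hu => inv_anti₀ (hy.trans_le (pa hu.2)) (pa hu.1)
  have Hder : ∀ {w}, 0 < p w → HasDerivAt H (p w)⁻¹ w := fun {w} hw =>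
    intervalIntegral.integral_hasDerivAt_right (ii p0 hw)
      (pc.measurable.inv.stronglyMeasurable.stronglyMeasurableAtFilter)
      (pc.continuousAt.inv₀ hw.ne')
  have Hbig : ∀ k : ℕ, ∃ w, a ≤ w ∧ 0 < ψ w ∧ (k : ℝ) / 2 ≤ H w := by
    intro k
    induction k with
    | zero => exact ⟨a, le_rfl, hpos, by simp [hH]⟩
    | succ k ih =>
      obtain ⟨w, haw, hw, hk⟩ := ih
      obtain ⟨z, hz, hwz⟩ := ((ht.eventually_lt_const (half_pos hw)).and
        (Filter.eventually_ge_atTop w)).exists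
      obtain ⟨v, hv, hv'⟩ := intermediate_value_Icc' hwz hc.continuousOn
        ⟨hz.le, (half_le_self hw.le)⟩
      have hpv : p v = ψ w / 2 := by simp only [hp]; rw [max_eq_left (haw.trans hv.1), hv']
      have hpw : p w = ψ w := by simp only [hp]; rw [max_eq_left haw]
      refine ⟨v, haw.trans hv.1, by linarith, ?_⟩
      have h1 := Hsub hv.1 (by linarith)
      have h2 : (1 : ℝ) / 2 ≤ (v - w) / p w := by
        rw [hpw, le_div_iff₀ hw]
        linarith [hs w v hv.1]
      push_cast
      linarith
  have Hsurj : ∀ s : ℝ, ∃ w, 0 < p w ∧ H w = lam * s := by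
    intro s
    obtain ⟨k, hk⟩ := exists_nat_ge (2 * (lam * s))
    obtain ⟨y, hay, hy, hky⟩ := Hbig k
    have hpy : 0 < p y := by simpa only [hp, max_eq_left hay] using hy
    set x := a - |lam * s| * ψ a with hx
    have hxa : x ≤ a := by
      have := mul_nonneg (abs_nonneg (lam * s)) hpos.le
      linarith
    have h1 := Hsub hxa p0
    have hpx : p x = ψ a := by simp only [hp, max_eq_right hxa]
    have h2 : (a - x) / p x = |lam * s| := by
      rw [hpx, hx]; field_simp; ring
    have h3 : H a = 0 := by simp [hH]
    have h4 := neg_abs_le (lam * s)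
    obtain ⟨w, hw, hw'⟩ := intermediate_value_Icc (f := H) (hxa.trans hay)
      (fun u hu => (Hder (hpy.trans_le (pa hu.2))).continuousAt.continuousWithinAt)
      (show lam * s ∈ Icc (H x) (H y) from ⟨by linarith, by linarith⟩)
    exact ⟨w, hpy.trans_le (pa hw.2), hw'⟩
  choose m hm hHm using Hsurj
  have mono : StrictMono m := by
    intro s s' hss
    by_contra! hle
    have h1 := Hsub hle (hm s)
    have h2 : 0 ≤ (m s - m s') / p (m s') := div_nonneg (by linarith) (hm s').le
    rw [hHm, hHm] at h1
    have := mul_lt_mul_of_pos_left hss hlam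
    linarith
  have lip : LipschitzWith (Real.toNNReal (ψ a * lam)) m := by
    refine LipschitzWith.of_le_add_mul' _ fun x y => ?_
    rcases le_total x y with hxy | hxy
    · have := mono.monotone hxy
      have := mul_nonneg (mul_pos hpos hlam).le (dist_nonneg (x := x) (y := y))
      linarith
    · have h1 := Hsub (mono.monotone hxy) (hm x)
      rw [hHm, hHm, div_le_iff₀ (hm y)] at h1
      rw [Real.dist_eq, abs_of_nonneg (sub_nonneg.2 hxy)]
      have h2 : (lam * x - lam * y) * p (m y) ≤ (lam * x - lam * y) * ψ a :=
        mul_le_mul_of_nonneg_left (ple _) (by nlinarith)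
      linarith
  have m0 : m 0 = a := by
    have h0 : H (m 0) = H a := by rw [hHm]; simp [hH]
    rcases lt_trichotomy (m 0) a with h | h | h
    · have := Hsub h.le p0
      have : 0 < (a - m 0) / p (m 0) := div_pos (by linarith) (hm 0)
      linarith
    · exact h
    · have := Hsub h.le (hm 0)
      have : 0 < (m 0 - a) / p a := div_pos (by linarith) p0
      linarith
  refine ⟨m, mono, lip.continuous, m0, fun s => (hm s).trans_le (ha (le_max_left _ _)), ?_⟩
  intro s hs0
  have hms : p (m s) = ψ (m s) := by
    simp only [hp, max_eq_left (m0 ▸ (mono hs0).le : a ≤ m s)]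
  have h1 : HasDerivAt (fun w => H w / lam) ((p (m s))⁻¹ / lam) (m s) :=
    (Hder (hm s)).div_const lam
  have h2 := h1.of_local_left_inverse lip.continuous.continuousAt
    (div_ne_zero (inv_ne_zero (hm s).ne') hlam.ne')
    (.of_forall fun y => by rw [hHm, mul_div_cancel_left₀ _ hlam.ne'])
  rwa [hms, inv_div, div_inv_eq_mul] at h2

/-! ### Exponential waiting times -/

lemma ae_expMeasure_nonneg (lam : ℝ) : ∀ᵐ d ∂expMeasure lam, 0 ≤ d := by
  rw [ae_iff]
  have : {d : ℝ | ¬ 0 ≤ d} = Iio 0 := by ext; simp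
  rw [this, expMeasure, gammaMeasure, withDensity_apply _ measurableSet_Iio]
  exact lintegral_gammaPDF_of_nonpos le_rfl

lemma integral_expMeasure {lam : ℝ} (hlam : 0 < lam) (f : ℝ → ℝ) :
    ∫ d, f d ∂expMeasure lam = ∫ d in Ioi 0, lam * Real.exp (-(lam * d)) * f d := by
  have hm : Measurable (gammaPDF 1 lam) := (measurable_gammaPDFReal 1 lam).ennreal_ofReal
  rw [expMeasure, gammaMeasure, integral_withDensity_eq_integral_toReal_smul hm
    (.of_forall fun _ => ENNReal.ofReal_lt_top), ← integral_Ici_eq_integral_Ioi,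
    ← integral_indicator measurableSet_Ici]
  refine integral_congr_ae (.of_forall fun d => ?_)
  change (exponentialPDF lam d).toReal • f d = _
  rw [exponentialPDF_eq]
  by_cases hd : 0 ≤ d
  · simp [hd, ENNReal.toReal_ofReal (mul_pos hlam (Real.exp_pos _)).le]
  · simp [hd]

lemma integral_expMeasure_comp_max_sub {lam : ℝ} (hlam : 0 < lam) {K : ℝ → ℝ} {s : ℝ} (hs : 0 ≤ s)
    (hK : IntervalIntegrable K volume 0 s) :
    ∫ d, K (max (s - d) 0) ∂expMeasure lam =
      Real.exp (-(lam * s)) * K 0 + ∫ u in (0 : ℝ)..s, lam * Real.exp (-(lam * (s - u))) * K u := by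
  rw [integral_expMeasure hlam]
  have hexp : IntegrableOn (fun d => lam * Real.exp (-(lam * d))) (Ioi s) := by
    have := (exp_neg_integrableOn_Ioi s hlam).const_mul lam
    simp only [neg_mul] at this
    exact this
  have e2 : EqOn (fun d => lam * Real.exp (-(lam * d)) * K (max (s - d) 0))
      (fun d => lam * Real.exp (-(lam * d)) * K 0) (Ioi s) := fun d hd => by
    simp only [max_eq_right (sub_nonpos.2 (le_of_lt (mem_Ioi.1 hd)))]
  have e1 : EqOn (fun d => lam * Real.exp (-(lam * d)) * K (max (s - d) 0))
      (fun d => lam * Real.exp (-(lam * d)) * K (s - d)) (uIcc 0 s) := fun d hd => by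
    rw [uIcc_of_le hs] at hd
    simp only [max_eq_left (sub_nonneg.2 hd.2)]
  have hKs : IntervalIntegrable (fun d => K (s - d)) volume 0 s := by
    simpa using (hK.comp_sub_left s).symm
  have i1 : IntervalIntegrable (fun d => lam * Real.exp (-(lam * d)) * K (max (s - d) 0))
      volume 0 s :=
    (hKs.continuousOn_mul (f := fun d => K (s - d)) (by fun_prop)).congr (fun d hd => (e1 (uIoc_subset_uIcc hd)).symm)
  have i2 : IntegrableOn (fun d => lam * Real.exp (-(lam * d)) * K (max (s - d) 0)) (Ioi s) :=
    IntegrableOn.congr_fun (hexp.mul_const (K 0)) e2.symm measurableSet_Ioi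
  rw [← Ioc_union_Ioi_eq_Ioi hs, setIntegral_union (Ioc_disjoint_Ioi le_rfl) measurableSet_Ioi
    ((intervalIntegrable_iff_integrableOn_Ioc_of_le hs).1 i1) i2,
    setIntegral_congr_fun measurableSet_Ioi e2, integral_mul_const, integral_const_mul, add_comm,
    ← intervalIntegral.integral_of_le hs, intervalIntegral.integral_congr e1]
  congr 1
  · have := integral_exp_mul_Ioi (neg_neg_of_pos hlam) s
    simp only [neg_mul] at this
    rw [this]
    field_simp
  · have := intervalIntegral.integral_comp_sub_left (a := 0) (b := s)
      (fun u => lam * Real.exp (-(lam * (s - u))) * K u) s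
    simpa using this

/-- The renewal equation at the next arrival, read off from a differential equation: if
`G' = lam * (K - G)` outside a countable set, then `G s` is the expectation of `K` at the time left
after an exponential waiting time. -/
lemma integral_expMeasure_eq_of_hasDerivAt {lam : ℝ} (hlam : 0 < lam) {K G : ℝ → ℝ} {s : ℝ}
    (hs : 0 ≤ s) (hK : IntervalIntegrable K volume 0 s) (hG : ContinuousOn G (Icc 0 s))
    (h0 : K 0 = G 0) {c : Set ℝ} (hc : c.Countable)
    (hd : ∀ u ∈ Ioo 0 s \ c, HasDerivAt G (lam * (K u - G u)) u) :
    ∫ d, K (max (s - d) 0) ∂expMeasure lam = G s := by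
  rw [integral_expMeasure_comp_max_sub hlam hs hK,
    integral_eq_of_hasDerivAt_off_countable_of_le
      (fun u => Real.exp (-(lam * (s - u))) * G u) _ hs hc ?_ ?_ ?_, h0]
  · simp
  · exact ContinuousOn.mul (by fun_prop) hG
  · intro u hu
    have h1 : HasDerivAt (fun u => Real.exp (-(lam * (s - u))))
        (Real.exp (-(lam * (s - u))) * lam) u := by
      have := (((hasDerivAt_id u).const_sub s).const_mul lam).neg.exp
      simpa using this
    exact (h1.mul (hd u hu)).congr_deriv (by ring)
  · exact hK.continuousOn_mul (by fun_prop)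

/-! ### Sample paths of the bidding process -/

lemma timeLeft_nonneg {d : ℕ → ℝ} {t : ℝ} (ht : 0 ≤ t) : ∀ n, 0 ≤ timeLeft d t n
  | 0 => ht
  | _ + 1 => le_max_right _ _

lemma antitone_timeLeft {d : ℕ → ℝ} (hd : ∀ i, 0 ≤ d i) {t : ℝ} (ht : 0 ≤ t) :
    Antitone (timeLeft d t) :=
  antitone_nat_of_succ_le fun n => max_le (by linarith [hd n]) (timeLeft_nonneg ht n)

lemma timeLeft_mem_Icc {d : ℕ → ℝ} (hd : ∀ i, 0 ≤ d i) {t : ℝ} (ht : 0 ≤ t) (n : ℕ) :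
    timeLeft d t n ∈ Icc 0 t :=
  ⟨timeLeft_nonneg ht n, antitone_timeLeft hd ht (Nat.zero_le n)⟩

lemma salePrice_eq_offer {A : Set (ℝ × ℝ)} {d x : ℕ → ℝ} {x₀ t : ℝ} {n : ℕ}
    (hn : Accepts A d x t n) (hlt : ∀ i < n, ¬ Accepts A d x t i) :
    salePrice A d x x₀ t = x n := by
  classical
  have h : ∃ i, Accepts A d x t i := ⟨n, hn⟩
  rw [salePrice, dif_pos h]
  congr 1
  rw [Nat.find_eq_iff]
  exact ⟨hn, hlt⟩

lemma salePrice_eq_residual {A : Set (ℝ × ℝ)} {d x : ℕ → ℝ} {x₀ t : ℝ}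
    (h : ∀ i, ¬ Accepts A d x t i) : salePrice A d x x₀ t = x₀ :=
  dif_neg (by simpa using h)

lemma salePrice_eq_offer_or {A : Set (ℝ × ℝ)} {d x : ℕ → ℝ} (x₀ t : ℝ) :
    (∃ n, Accepts A d x t n ∧ salePrice A d x x₀ t = x n) ∨ salePrice A d x x₀ t = x₀ := by
  classical
  by_cases h : ∃ i, Accepts A d x t i
  · exact .inl ⟨Nat.find h, Nat.find_spec h, dif_pos h⟩
  · exact .inr (dif_neg h)

/-! ### Independence of the next arrival from the past -/

/-- The information carried by the first `n` waiting times and offers. -/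
@[reducible] def pastSigma {Ω : Type*} (D X : ℕ → Ω → ℝ) (n : ℕ) : MeasurableSpace Ω :=
  ⨆ i : Fin n, (MeasurableSpace.comap (D i) inferInstance ⊔
    MeasurableSpace.comap (X i) inferInstance)

section Bidding

variable {Ω : Type*} {D X : ℕ → Ω → ℝ}

lemma measurable_wait_pastSigma {i n : ℕ} (h : i < n) : Measurable[pastSigma D X n] (D i) :=
  measurable_iff_comap_le.2 (le_iSup_of_le (⟨i, h⟩ : Fin n) le_sup_left)

lemma measurable_offer_pastSigma {i n : ℕ} (h : i < n) : Measurable[pastSigma D X n] (X i) :=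
  measurable_iff_comap_le.2 (le_iSup_of_le (⟨i, h⟩ : Fin n) le_sup_right)

lemma pastSigma_le {mΩ : MeasurableSpace Ω} (hD : ∀ i, Measurable (D i))
    (hX : ∀ i, Measurable (X i)) (n : ℕ) : pastSigma D X n ≤ mΩ :=
  iSup_le fun i => sup_le (hD i).comap_le (hX i).comap_le

lemma measurable_timeLeft {mΩ : MeasurableSpace Ω} {n : ℕ} (h : ∀ i < n, Measurable (D i))
    (t : ℝ) : Measurable fun ω => timeLeft (D · ω) t n := by
  induction n with
  | zero => exact measurable_const
  | succ n ih =>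
    exact ((ih fun i hi => h i (hi.trans n.lt_succ_self)).sub (h n n.lt_succ_self)).max
      measurable_const

lemma measurableSet_accepts {mΩ : MeasurableSpace Ω} {A : Set (ℝ × ℝ)} (hA : MeasurableSet A)
    {n : ℕ} (h : ∀ i < n + 1, Measurable (D i)) (hX : Measurable (X n)) (t : ℝ) :
    MeasurableSet {ω | Accepts A (D · ω) (X · ω) t n} :=
  (measurableSet_lt measurable_const (measurable_timeLeft h t)).inter
    (((measurable_timeLeft h t).prodMk hX) hA)

lemma measurableSet_forall_not_accepts {mΩ : MeasurableSpace Ω} {A : Set (ℝ × ℝ)}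
    (hA : MeasurableSet A) {n : ℕ} (hD : ∀ i < n, Measurable (D i)) (hX : ∀ i < n, Measurable (X i))
    (t : ℝ) : MeasurableSet {ω | ∀ i < n, ¬ Accepts A (D · ω) (X · ω) t i} := by
  have : {ω | ∀ i < n, ¬ Accepts A (D · ω) (X · ω) t i} =
      ⋂ i : Fin n, {ω | Accepts A (D · ω) (X · ω) t i}ᶜ := by
    ext ω
    simp [Fin.forall_iff]
  rw [this]
  exact MeasurableSet.iInter fun i => (measurableSet_accepts hA
    (fun j hj => hD j (by omega)) (hX i i.2) t).compl

lemma measurable_salePrice {mΩ : MeasurableSpace Ω} {A : Set (ℝ × ℝ)} (hA : MeasurableSet A)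
    (hD : ∀ i, Measurable (D i)) (hX : ∀ i, Measurable (X i)) {X₀ : Ω → ℝ} (hX₀ : Measurable X₀)
    (t : ℝ) : Measurable fun ω => salePrice A (D · ω) (X · ω) (X₀ ω) t := by
  classical
  have hacc : ∀ n, MeasurableSet {ω | Accepts A (D · ω) (X · ω) t n} := fun n =>
    measurableSet_accepts hA (fun i _ => hD i) (hX n) t
  set E : Set Ω := {ω | ∃ i, Accepts A (D · ω) (X · ω) t i} with hE
  have hEm : MeasurableSet E := by
    have : E = ⋃ i, {ω | Accepts A (D · ω) (X · ω) t i} := by ext; simp [hE]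
    rw [this]
    exact MeasurableSet.iUnion hacc
  -- on the event that nothing is accepted the search is stopped at `0`
  have hex : ∀ ω, ∃ n, Accepts A (D · ω) (X · ω) t n ∨ ω ∉ E := fun ω => by
    by_cases h : ω ∈ E
    · exact h.imp fun _ => Or.inl
    · exact ⟨0, .inr h⟩
  have hm : Measurable fun ω => X (Nat.find (hex ω)) ω :=
    Measurable.find (p := fun n ω => Accepts A (D · ω) (X · ω) t n ∨ ω ∉ E) hX
      (fun n => (hacc n).union hEm.compl) hex
  have heq : (fun ω => salePrice A (D · ω) (X · ω) (X₀ ω) t) =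
      fun ω => if ω ∈ E then X (Nat.find (hex ω)) ω else X₀ ω := by
    ext ω
    by_cases hω : ω ∈ E
    · rw [if_pos hω]
      refine salePrice_eq_offer ((Nat.find_spec (hex ω)).resolve_right (not_not.2 hω)) ?_
      exact fun i hi hacc => Nat.find_min (hex ω) hi (.inl hacc)
    · rw [if_neg hω]
      exact salePrice_eq_residual fun i hi => hω ⟨i, hi⟩
  rw [heq]
  exact Measurable.ite hEm hm hX₀

lemma indep_pastSigma [mΩ : MeasurableSpace Ω] {P : Measure Ω} {lam : ℝ} {ν ν₀ : Measure ℝ}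
    {X₀ : Ω → ℝ} (hproc : IsBiddingProcess P lam ν ν₀ D X X₀)
    (hD : ∀ i, Measurable (D i)) (hX : ∀ i, Measurable (X i)) (hX₀ : Measurable X₀) (n : ℕ) :
    Indep (pastSigma D X n) (MeasurableSpace.comap (D n) inferInstance ⊔
      MeasurableSpace.comap (X n) inferInstance) P ∧
    Indep (pastSigma D X n) (MeasurableSpace.comap X₀ inferInstance) P := by
  set Z : ℕ ⊕ (ℕ ⊕ Unit) → Ω → ℝ := Sum.elim D (Sum.elim X fun _ => X₀) with hZ
  have hle : ∀ j, MeasurableSpace.comap (Z j) inferInstance ≤ mΩ := by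
    rintro (i | i | _)
    · exact (hD i).comap_le
    · exact (hX i).comap_le
    · exact hX₀.comap_le
  set S : Set (ℕ ⊕ (ℕ ⊕ Unit)) := {j | ∃ i < n, j = .inl i ∨ j = .inr (.inl i)} with hS
  have hpast : pastSigma D X n ≤ ⨆ j ∈ S, MeasurableSpace.comap (Z j) inferInstance :=
    iSup_le fun i => sup_le
      (le_iSup₂_of_le (.inl (i : ℕ)) ⟨i, i.2, .inl rfl⟩ le_rfl)
      (le_iSup₂_of_le (.inr (.inl (i : ℕ))) ⟨i, i.2, .inr rfl⟩ le_rfl)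
  have key : ∀ T : Set (ℕ ⊕ (ℕ ⊕ Unit)), Disjoint S T →
      Indep (pastSigma D X n) (⨆ j ∈ T, MeasurableSpace.comap (Z j) inferInstance) P :=
    fun T hT => indep_of_indep_of_le_left (indep_iSup_of_disjoint hle hproc.indep hT) hpast
  constructor
  · refine indep_of_indep_of_le_right (key {.inl n, .inr (.inl n)} ?_) (sup_le
      (le_iSup₂_of_le (.inl n) (by simp) le_rfl) (le_iSup₂_of_le (.inr (.inl n)) (by simp) le_rfl))
    rw [Set.disjoint_right]
    rintro j (rfl | rfl) ⟨i, hi, h | h⟩ <;> simp at h <;> omega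
  · refine indep_of_indep_of_le_right (key {.inr (.inr ())} ?_)
      (le_iSup₂_of_le (.inr (.inr ())) (by simp) le_rfl)
    rw [Set.disjoint_right]
    rintro j rfl ⟨i, hi, h | h⟩ <;> simp at h

end Bidding

lemma integral_nonpos_of_indepFun {Ω β γ : Type*} [MeasurableSpace Ω] [MeasurableSpace β]
    [MeasurableSpace γ] {P : Measure Ω} [IsProbabilityMeasure P] {Y : Ω → β} {Z : Ω → γ}
    (hY : Measurable Y) (hZ : Measurable Z) (hYZ : IndepFun Y Z P) {h : β × γ → ℝ}
    (hh : Measurable h) (hint : Integrable (fun ω => h (Y ω, Z ω)) P)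
    (hle : ∀ᵐ ω ∂P, ∫ z, h (Y ω, z) ∂(P.map Z) ≤ 0) : ∫ ω, h (Y ω, Z ω) ∂P ≤ 0 := by
  have hpair := (indepFun_iff_map_prod_eq_prod_map_map hY.aemeasurable hZ.aemeasurable).1 hYZ
  have hYZm : Measurable fun ω => (Y ω, Z ω) := hY.prodMk hZ
  have := Measure.isProbabilityMeasure_map (μ := P) hZ.aemeasurable
  have := Measure.isProbabilityMeasure_map (μ := P) hY.aemeasurable
  have hi : Integrable h ((P.map Y).prod (P.map Z)) := by
    rw [← hpair]
    exact (integrable_map_measure hh.aestronglyMeasurable hYZm.aemeasurable).2 hint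
  rw [← integral_map (φ := fun ω => (Y ω, Z ω)) hYZm.aemeasurable hh.aestronglyMeasurable, hpair,
    integral_prod _ hi]
  refine integral_nonpos_of_ae ((ae_map_iff hY.aemeasurable ?_).2 hle)
  exact measurableSet_le (hh.stronglyMeasurable.integral_prod_right'.measurable) measurable_const

section Bidding

variable {Ω : Type*} {D X : ℕ → Ω → ℝ} {X₀ : Ω → ℝ} [mΩ : MeasurableSpace Ω] {P : Measure Ω}
  {lam : ℝ} {ν ν₀ : Measure ℝ}

lemma ae_wait_nonneg (hproc : IsBiddingProcess P lam ν ν₀ D X X₀) :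
    ∀ᵐ ω ∂P, ∀ i, 0 ≤ D i ω := by
  rw [ae_all_iff]
  intro i
  have h := ae_expMeasure_nonneg lam
  rw [← (hproc.hasLaw_wait i).map_eq] at h
  exact ae_of_ae_map (hproc.hasLaw_wait i).aemeasurable h

lemma indepFun_pastSigma {β : Type*} [MeasurableSpace β]
    (hproc : IsBiddingProcess P lam ν ν₀ D X X₀)
    (hD : ∀ i, Measurable (D i)) (hX : ∀ i, Measurable (X i)) (hX₀ : Measurable X₀) {n : ℕ}
    {Y : Ω → β} (hY : Measurable[pastSigma D X n] Y) :
    IndepFun Y (fun ω => (D n ω, X n ω)) P ∧ IndepFun Y X₀ P := by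
  obtain ⟨h1, h2⟩ := indep_pastSigma hproc hD hX hX₀ n
  refine ⟨?_, indep_of_indep_of_le_left h2 hY.comap_le⟩
  refine indep_of_indep_of_le_left (indep_of_indep_of_le_right h1 ?_) hY.comap_le
  exact (MeasurableSpace.comap_prodMk (D n) (X n)).le

lemma map_wait_offer [IsProbabilityMeasure P] (hproc : IsBiddingProcess P lam ν ν₀ D X X₀)
    (n : ℕ) : P.map (fun ω => (D n ω, X n ω)) = (expMeasure lam).prod ν := by
  have h : IndepFun (D n) (X n) P :=
    hproc.indep.indepFun (i := .inl n) (j := .inr (.inl n)) (by simp)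
  rw [(indepFun_iff_map_prod_eq_prod_map_map (hproc.hasLaw_wait n).aemeasurable
    (hproc.hasLaw_offer n).aemeasurable).1 h, (hproc.hasLaw_wait n).map_eq,
    (hproc.hasLaw_offer n).map_eq]

/-! ### The number of offers before the deadline -/

/-- As long as time is left, every waiting time has been shorter than `t`. Hence the probability
that time is left after `n` arrivals decays geometrically. -/
lemma measure_timeLeft_pos_le [IsProbabilityMeasure P]
    (hproc : IsBiddingProcess P lam ν ν₀ D X X₀)
    (hD : ∀ i, Measurable (D i)) (hX : ∀ i, Measurable (X i)) (hX₀ : Measurable X₀)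
    {t : ℝ} (ht : 0 ≤ t) (n : ℕ) :
    P {ω | 0 < timeLeft (D · ω) t n} ≤ (expMeasure lam (Iio t)) ^ n := by
  induction n with
  | zero => simpa using prob_le_one
  | succ n ih =>
    set E : Set Ω := {ω | 0 < timeLeft (D · ω) t n}
    have hEm : MeasurableSet[pastSigma D X n] E := by
      have := measurable_timeLeft (mΩ := pastSigma D X n)
        (fun i hi => measurable_wait_pastSigma (D := D) (X := X) hi) t
      exact this measurableSet_Ioi
    have hsub : {ω | 0 < timeLeft (D · ω) t (n + 1)} ≤ᵐ[P] (E ∩ D n ⁻¹' Iio t : Set Ω) := by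
      filter_upwards [ae_wait_nonneg hproc] with ω hω h
      have h1 : 0 < timeLeft (D · ω) t n - D n ω := by
        have h : 0 < max (timeLeft (D · ω) t n - D n ω) 0 := h
        simpa using h
      have h2 := (timeLeft_mem_Icc hω ht n).2
      exact ⟨show 0 < timeLeft (D · ω) t n by linarith [hω n], show D n ω < t by linarith⟩
    have hind : P (E ∩ D n ⁻¹' Iio t) = P E * P (D n ⁻¹' Iio t) :=
      (Indep_iff _ _ P).1 (indep_pastSigma hproc hD hX hX₀ n).1 E _ hEm
        ((le_sup_left : MeasurableSpace.comap (D n) inferInstance ≤ _) _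
          ⟨Iio t, measurableSet_Iio, rfl⟩)
    have hlaw : P (D n ⁻¹' Iio t) = expMeasure lam (Iio t) := by
      rw [← (hproc.hasLaw_wait n).map_eq, Measure.map_apply (hD n) measurableSet_Iio]
    calc P {ω | 0 < timeLeft (D · ω) t (n + 1)} ≤ P (E ∩ D n ⁻¹' Iio t) := measure_mono_ae hsub
      _ = P E * expMeasure lam (Iio t) := by rw [hind, hlaw]
      _ ≤ _ := by rw [pow_succ]; gcongr

lemma expMeasure_Iio_lt_one {lam : ℝ} (hlam : 0 < lam) (t : ℝ) : expMeasure lam (Iio t) < 1 := by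
  have := isProbabilityMeasure_expMeasure hlam
  refine (measure_mono Iio_subset_Iic_self).trans_lt ?_
  rw [← ofReal_cdf, cdf_expMeasure_eq hlam, ← ENNReal.ofReal_one]
  refine (ENNReal.ofReal_lt_ofReal_iff zero_lt_one).2 ?_
  split_ifs
  · linarith [Real.exp_pos (-(lam * t))]
  · exact zero_lt_one

lemma tendsto_measure_timeLeft_pos [IsProbabilityMeasure P] (hlam : 0 < lam)
    (hproc : IsBiddingProcess P lam ν ν₀ D X X₀)
    (hD : ∀ i, Measurable (D i)) (hX : ∀ i, Measurable (X i)) (hX₀ : Measurable X₀)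
    {t : ℝ} (ht : 0 ≤ t) :
    Filter.Tendsto (fun n => P {ω | 0 < timeLeft (D · ω) t n}) Filter.atTop (nhds 0) :=
  tendsto_of_tendsto_of_tendsto_of_le_of_le tendsto_const_nhds
    (ENNReal.tendsto_pow_atTop_nhds_zero_of_lt_one (expMeasure_Iio_lt_one hlam t))
    (fun _ => zero_le) (measure_timeLeft_pos_le hproc hD hX hX₀ ht)

/-- A policy that accepts no negative offers has a square integrable sale price: its square is at
most the sum of `X₀ ^ 2` and of the squared positive parts of all the offers that arrive in time,
and the expected number of these is finite. -/
lemma memLp_salePrice [IsProbabilityMeasure P] (hlam : 0 < lam)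
    (hproc : IsBiddingProcess P lam ν ν₀ D X X₀)
    (hD : ∀ i, Measurable (D i)) (hX : ∀ i, Measurable (X i)) (hX₀ : Measurable X₀)
    (h₀ : Integrable (fun x : ℝ => x ^ 2) ν₀) (h : Integrable (fun x : ℝ => (max x 0) ^ 2) ν)
    {A : Set (ℝ × ℝ)} (hA : MeasurableSet A) (hA0 : ∀ p ∈ A, 0 ≤ p.2) {t : ℝ} (ht : 0 ≤ t) :
    MemLp (fun ω => salePrice A (D · ω) (X · ω) (X₀ ω) t) 2 P := by
  have hm := measurable_salePrice hA hD hX hX₀ t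
  rw [memLp_two_iff_integrable_sq hm.aestronglyMeasurable]
  refine ⟨(hm.pow_const 2).aestronglyMeasurable, ?_⟩
  set E : ℕ → Set Ω := fun n => {ω | 0 < timeLeft (D · ω) t n}
  have hEm : ∀ n, MeasurableSet[pastSigma D X n] (E n) := fun n => by
    have := measurable_timeLeft (mΩ := pastSigma D X n)
      (fun i hi => measurable_wait_pastSigma (D := D) (X := X) hi) t
    exact this measurableSet_Ioi
  have hEm' : ∀ n, MeasurableSet (E n) := fun n => pastSigma_le hD hX n _ (hEm n)
  have hbound : ∀ᵐ ω ∂P, ‖salePrice A (D · ω) (X · ω) (X₀ ω) t ^ 2‖ₑ ≤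
      ‖X₀ ω ^ 2‖ₑ + ∑' n, (E n).indicator (fun _ => 1) ω * ‖(max (X n ω) 0) ^ 2‖ₑ := by
    filter_upwards [ae_wait_nonneg hproc] with ω hω
    rcases salePrice_eq_offer_or (A := A) (d := (D · ω)) (x := (X · ω)) (X₀ ω) t with
      ⟨n, hn, hS⟩ | hS
    · have h1 : ω ∈ E n := hn.1.trans_le (antitone_timeLeft hω ht n.le_succ)
      have h2 : 0 ≤ X n ω := hA0 _ hn.2
      rw [hS]
      refine le_add_left (le_trans ?_ (ENNReal.le_tsum n))
      simp [h1, max_eq_left h2]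
    · rw [hS]
      exact le_self_add
  have hterm : ∀ n, ∫⁻ ω, (E n).indicator (fun _ => 1) ω * ‖(max (X n ω) 0) ^ 2‖ₑ ∂P ≤
      (expMeasure lam (Iio t)) ^ n * ∫⁻ x, ‖(max x 0) ^ 2‖ₑ ∂ν := by
    intro n
    have hXn : Measurable[MeasurableSpace.comap (D n) inferInstance ⊔
        MeasurableSpace.comap (X n) inferInstance] (X n) :=
      measurable_iff_comap_le.2 le_sup_right
    have hg : Measurable fun x : ℝ => ‖(max x 0) ^ 2‖ₑ := by fun_prop
    have hI : Measurable[pastSigma D X n] ((E n).indicator fun _ => (1 : ENNReal)) :=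
      measurable_const.indicator (hEm n)
    calc ∫⁻ ω, (E n).indicator (fun _ => 1) ω * ‖(max (X n ω) 0) ^ 2‖ₑ ∂P
        = (∫⁻ ω, (E n).indicator (fun _ => 1) ω ∂P) * ∫⁻ ω, ‖(max (X n ω) 0) ^ 2‖ₑ ∂P :=
          lintegral_mul_eq_lintegral_mul_lintegral_of_independent_measurableSpace
            (pastSigma_le hD hX n) (sup_le (hD n).comap_le (hX n).comap_le)
            (indep_pastSigma hproc hD hX hX₀ n).1 hI (hg.comp hXn)
      _ = P (E n) * ∫⁻ x, ‖(max x 0) ^ 2‖ₑ ∂ν := by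
          rw [lintegral_indicator_const (hEm' n), one_mul, ← (hproc.hasLaw_offer n).map_eq,
            lintegral_map hg (hX n)]
      _ ≤ _ := by
          gcongr
          exact measure_timeLeft_pos_le hproc hD hX hX₀ ht n
  rw [hasFiniteIntegral_iff_enorm]
  refine (lintegral_mono_ae hbound).trans_lt ?_
  have hterm_meas : ∀ n, AEMeasurable
      (fun ω => (E n).indicator (fun _ => 1) ω * ‖(max (X n ω) 0) ^ 2‖ₑ) P := fun n =>
    (Measurable.mul (measurable_const.indicator (hEm' n)) (by fun_prop)).aemeasurable
  rw [lintegral_add_left (by fun_prop), lintegral_tsum hterm_meas]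
  refine ENNReal.add_lt_top.2 ⟨?_, (ENNReal.tsum_le_tsum hterm).trans_lt ?_⟩
  · rw [← lintegral_map (f := fun x : ℝ => ‖x ^ 2‖ₑ) (by fun_prop) hX₀,
      hproc.hasLaw_residual.map_eq]
    exact h₀.2
  · rw [ENNReal.tsum_mul_right, ENNReal.tsum_geometric]
    refine ENNReal.mul_lt_top ?_ h.2
    rw [ENNReal.inv_lt_top]
    exact tsub_pos_of_lt (expMeasure_Iio_lt_one hlam t)

/-! ### Optional stopping for policies -/

open Classical in
/-- What the policy `A` leads to when the time `s` is left, the next waiting time is `z.1` and the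
next offer is `z.2`: the payoff `f` of this offer if it is accepted, and the continuation
value `G` at the new remaining time otherwise. -/
noncomputable def stepValue (A : Set (ℝ × ℝ)) (f G : ℝ → ℝ) (s : ℝ) (z : ℝ × ℝ) : ℝ :=
  if 0 < max (s - z.1) 0 ∧ (max (s - z.1) 0, z.2) ∈ A then f z.2 else G (max (s - z.1) 0)

/-- The verification inequality: if the continuation value `G` does not increase on average over one
step, up to an integrable upper bound `B` of the increment, then no more than `G t` can be expected
from the policy `A`. The truncated payoffs "`f` of the sale price if the sale takes place among the
first `n` offers, `G` of the remaining time otherwise" form a supermartingale; it converges to the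
payoff because the remaining time eventually vanishes. The bound `B` is needed because for a general
policy the increment itself need not be integrable. -/
theorem integral_payoff_le [IsProbabilityMeasure P] (hlam : 0 < lam)
    (hproc : IsBiddingProcess P lam ν ν₀ D X X₀)
    (hD : ∀ i, Measurable (D i)) (hX : ∀ i, Measurable (X i)) (hX₀ : Measurable X₀)
    {t : ℝ} (ht : 0 ≤ t) {A : Set (ℝ × ℝ)} (hA : MeasurableSet A) {f G : ℝ → ℝ}
    (hf : Measurable f) (hG : Measurable G) {C : ℝ} (hGC : ∀ s ∈ Icc 0 t, |G s| ≤ C)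
    {g : ℝ → ℝ} (hg : Integrable g ν) {B : ℝ → ℝ × ℝ → ℝ} (hB : Measurable (Function.uncurry B))
    (hBg : ∀ s ∈ Icc 0 t, ∀ z, 0 ≤ z.1 → |B s z| ≤ g z.2)
    (hB0 : ∀ s ∈ Icc 0 t, ∫ z, B s z ∂((expMeasure lam).prod ν) ≤ 0)
    (hBA : ∀ s ∈ Icc 0 t, ∀ z, 0 ≤ z.1 → stepValue A f G s z - G s ≤ B s z)
    (hf₀ : Integrable f ν₀) (hfG : ∫ x, f x ∂ν₀ = G 0)
    (hS : Integrable (fun ω => f (salePrice A (D · ω) (X · ω) (X₀ ω) t)) P) :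
    ∫ ω, f (salePrice A (D · ω) (X · ω) (X₀ ω) t) ∂P ≤ G t := by
  classical
  set S : Ω → ℝ := fun ω => salePrice A (D · ω) (X · ω) (X₀ ω) t
  set T : ℕ → Ω → ℝ := fun n ω => timeLeft (D · ω) t n with hT
  set N : ℕ → Set Ω := fun n => {ω | ∀ i < n, ¬ Accepts A (D · ω) (X · ω) t i} with hN
  set Z : ℕ → Ω → ℝ := fun n ω => if ω ∈ N n then G (T n ω) else f (S ω) with hZ
  have hpos := ae_wait_nonneg hproc
  have hTm : ∀ n, Measurable (T n) := fun n => measurable_timeLeft (fun i _ => hD i) t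
  have hNm : ∀ n, MeasurableSet (N n) := fun n =>
    measurableSet_forall_not_accepts hA (fun i _ => hD i) (fun i _ => hX i) t
  have hTm' : ∀ n, Measurable[pastSigma D X n] (T n) := fun n =>
    measurable_timeLeft (mΩ := pastSigma D X n) (fun i hi => measurable_wait_pastSigma hi) t
  have hNm' : ∀ n, MeasurableSet[pastSigma D X n] (N n) := fun n =>
    measurableSet_forall_not_accepts (mΩ := pastSigma D X n) hA
      (fun i hi => measurable_wait_pastSigma hi) (fun i hi => measurable_offer_pastSigma hi) t
  have hSm : Measurable S := measurable_salePrice hA hD hX hX₀ t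
  have hZm : ∀ n, Measurable (Z n) := fun n =>
    Measurable.ite (hNm n) (hG.comp (hTm n)) (hf.comp hSm)
  have hZb : ∀ n, ∀ᵐ ω ∂P, ‖Z n ω‖ ≤ |f (S ω)| + C := by
    intro n
    filter_upwards [hpos] with ω hω
    have h1 := hGC _ (timeLeft_mem_Icc hω ht n)
    have h2 := abs_nonneg (f (S ω))
    have h3 := (abs_nonneg _).trans h1
    rw [Real.norm_eq_abs]
    simp only [hZ]
    split_ifs
    · linarith
    · linarith
  have hb : Integrable (fun ω => |f (S ω)| + C) P := hS.abs.add (integrable_const C)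
  have hZi : ∀ n, Integrable (Z n) P := fun n =>
    hb.mono' (hZm n).aestronglyMeasurable (hZb n)
  have hstep : ∀ n, ∫ ω, Z (n + 1) ω ∂P ≤ ∫ ω, Z n ω ∂P := by
    intro n
    set I : Ω → ℝ := (N n).indicator fun _ => 1 with hI
    have hIm : Measurable[pastSigma D X n] I := measurable_const.indicator (hNm' n)
    have hIm' : Measurable I := measurable_const.indicator (hNm n)
    set h : (ℝ × ℝ) × (ℝ × ℝ) → ℝ := fun p => p.1.2 * B p.1.1 p.2 with hh
    have hhm : Measurable h := by
      have : Measurable fun p : (ℝ × ℝ) × (ℝ × ℝ) => Function.uncurry B (p.1.1, p.2) :=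
        hB.comp (by fun_prop)
      exact Measurable.mul (by fun_prop) this
    have hWi : Integrable (fun ω => h ((T n ω, I ω), (D n ω, X n ω))) P := by
      have hgX : Integrable (fun ω => g (X n ω)) P := by
        have hg' := hg
        rw [← (hproc.hasLaw_offer n).map_eq] at hg'
        exact hg'.comp_measurable (hX n)
      refine hgX.mono' (hhm.comp (((hTm n).prodMk hIm').prodMk
        ((hD n).prodMk (hX n)))).aestronglyMeasurable ?_
      filter_upwards [hpos] with ω hω
      have h1 := hBg _ (timeLeft_mem_Icc hω ht n) (D n ω, X n ω) (hω n)
      by_cases hn : ω ∈ N n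
      · simpa [hh, hI, hn] using h1
      · simpa [hh, hI, hn] using (abs_nonneg _).trans h1
    have hW : ∫ ω, h ((T n ω, I ω), (D n ω, X n ω)) ∂P ≤ 0 := by
      refine integral_nonpos_of_indepFun ((hTm n).prodMk hIm') ((hD n).prodMk (hX n))
        (indepFun_pastSigma hproc hD hX hX₀ (Measurable.prodMk (hTm' n) hIm)).1 hhm hWi ?_
      filter_upwards [hpos] with ω hω
      rw [map_wait_offer hproc n]
      simp only [hh]
      rw [integral_const_mul]
      refine mul_nonpos_of_nonneg_of_nonpos (indicator_nonneg (fun _ _ => zero_le_one) _)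
        (hB0 _ (timeLeft_mem_Icc hω ht n))
    have hle : ∫ ω, (Z (n + 1) ω - Z n ω) ∂P ≤ ∫ ω, h ((T n ω, I ω), (D n ω, X n ω)) ∂P := by
      refine integral_mono_ae ((hZi _).sub (hZi _)) hWi ?_
      filter_upwards [hpos] with ω hω
      by_cases hn : ω ∈ N n
      · have h1 := hBA _ (timeLeft_mem_Icc hω ht n) (D n ω, X n ω) (hω n)
        have h2 : h ((T n ω, I ω), (D n ω, X n ω)) = B (T n ω) (D n ω, X n ω) := by
          simp [hh, hI, hn]
        rw [h2]
        refine le_trans (le_of_eq ?_) h1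
        have h3 : Z n ω = G (T n ω) := if_pos hn
        rw [h3]
        congr 1
        by_cases hacc : Accepts A (D · ω) (X · ω) t n
        · have h4 : ω ∉ N (n + 1) := fun h' => h' n n.lt_succ_self hacc
          have h5 : S ω = X n ω := salePrice_eq_offer hacc hn
          have h6 : Z (n + 1) ω = f (X n ω) := (if_neg h4).trans (by rw [h5])
          exact h6.trans (if_pos hacc).symm
        · have h4 : ω ∈ N (n + 1) := by
            intro i hi
            rcases Nat.lt_succ_iff_lt_or_eq.1 hi with h' | rfl
            · exact hn i h'
            · exact hacc
          have h6 : Z (n + 1) ω = G (T (n + 1) ω) := if_pos h4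
          exact h6.trans (if_neg hacc).symm
      · have h4 : ω ∉ N (n + 1) := fun h' => hn fun i hi => h' i (hi.trans n.lt_succ_self)
        simp [hZ, hn, h4, hh, hI]
    rw [integral_sub (hZi _) (hZi _)] at hle
    linarith
  have hZle : ∀ n, ∫ ω, Z n ω ∂P ≤ G t := by
    intro n
    induction n with
    | zero => simp [hZ, hN, hT, timeLeft]
    | succ n ih => exact (hstep n).trans ih
  set E : ℕ → Set Ω := fun n => {ω | 0 < T n ω}
  have hEm : ∀ n, MeasurableSet (E n) := fun n => hTm n measurableSet_Ioi
  have hEm' : ∀ n, MeasurableSet[pastSigma D X n] (E n) := fun n => hTm' n measurableSet_Ioi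
  have hf₀' : Integrable (fun ω => f (X₀ ω)) P := by
    rw [← hproc.hasLaw_residual.map_eq] at hf₀
    exact hf₀.comp_measurable hX₀
  have hfG' : ∫ ω, (f (X₀ ω) - G 0) ∂P = 0 := by
    rw [integral_sub hf₀' (integrable_const _), ← hfG, ← hproc.hasLaw_residual.map_eq,
      integral_map hX₀.aemeasurable hf.aestronglyMeasurable]
    simp
  -- once the time is up the payoff has mean `G 0`, whatever has been rejected before
  have hres : ∀ n, Integrable (fun ω =>
        (N n ∩ (E n)ᶜ).indicator (fun _ => (1 : ℝ)) ω * (f (X₀ ω) - G 0)) P ∧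
      ∫ ω, (N n ∩ (E n)ᶜ).indicator (fun _ => (1 : ℝ)) ω * (f (X₀ ω) - G 0) ∂P = 0 := by
    intro n
    have hm : Measurable[pastSigma D X n] ((N n ∩ (E n)ᶜ).indicator fun _ => (1 : ℝ)) :=
      measurable_const.indicator ((hNm' n).inter (hEm' n).compl)
    have hi : IndepFun ((N n ∩ (E n)ᶜ).indicator fun _ => (1 : ℝ)) (fun ω => f (X₀ ω) - G 0) P :=
      (indepFun_pastSigma hproc hD hX hX₀ hm).2.comp measurable_id (hf.sub_const (G 0))
    have hI1 : Integrable ((N n ∩ (E n)ᶜ).indicator fun _ => (1 : ℝ)) P :=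
      (integrable_const 1).indicator ((hNm n).inter (hEm n).compl)
    have hI2 : Integrable (fun ω => f (X₀ ω) - G 0) P := hf₀'.sub (integrable_const _)
    refine ⟨hi.integrable_mul hI1 hI2, ?_⟩
    have := hi.integral_mul_eq_mul_integral hI1.aestronglyMeasurable hI2.aestronglyMeasurable
    rw [hfG', mul_zero] at this
    exact this
  have hb2 : Integrable (fun ω => 2 * |f (S ω)| + C) P :=
    (hS.abs.const_mul 2).add (integrable_const C)
  have hdiff : ∀ n, ∫ ω, f (S ω) ∂P ≤ ∫ ω, Z n ω ∂P + ∫ ω in E n, (2 * |f (S ω)| + C) ∂P := by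
    intro n
    have h1 : ∫ ω, f (S ω) ∂P - ∫ ω, Z n ω ∂P ≤ ∫ ω, ((N n ∩ (E n)ᶜ).indicator
        (fun _ => (1 : ℝ)) ω * (f (X₀ ω) - G 0) +
          (E n).indicator (fun ω => 2 * |f (S ω)| + C) ω) ∂P := by
      rw [← integral_sub hS (hZi n)]
      refine integral_mono_ae (hS.sub (hZi n)) ((hres n).1.add (hb2.indicator (hEm n))) ?_
      filter_upwards [hpos, hZb n] with ω hω hZω
      have h0 := timeLeft_nonneg (d := (D · ω)) ht n
      rw [Real.norm_eq_abs] at hZω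
      change f (S ω) - Z n ω ≤ _
      by_cases he : ω ∈ E n
      · have h2 := neg_abs_le (Z n ω)
        have h3 := le_abs_self (f (S ω))
        simp [he]
        linarith
      · have hT0 : T n ω = 0 := le_antisymm (not_lt.1 he) h0
        by_cases hn : ω ∈ N n
        · have hno : ∀ i, ¬ Accepts A (D · ω) (X · ω) t i := by
            intro i hi
            rcases lt_or_ge i n with h' | h'
            · exact hn i h' hi
            · have h2 : T (i + 1) ω ≤ T n ω := antitone_timeLeft hω ht (by omega)
              have h3 : 0 < T (i + 1) ω := hi.1
              linarith
          have hSX : S ω = X₀ ω := salePrice_eq_residual hno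
          have h4 : Z n ω = G 0 := (if_pos hn).trans (by rw [hT0])
          simp [he, hn, h4, hSX]
        · have h4 : Z n ω = f (S ω) := if_neg hn
          simp [he, hn, h4]
    rw [integral_add (hres n).1 (hb2.indicator (hEm n)), (hres n).2,
      integral_indicator (hEm n)] at h1
    linarith
  have hlim : Filter.Tendsto (fun n => G t + ∫ ω in E n, (2 * |f (S ω)| + C) ∂P) Filter.atTop
      (nhds (G t + 0)) :=
    (hb2.tendsto_setIntegral_nhds_zero
      (tendsto_measure_timeLeft_pos hlam hproc hD hX hX₀ ht)).const_add _
  rw [add_zero] at hlim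
  exact ge_of_tendsto' hlim fun n => (hdiff n).trans (by linarith [hZle n])

end Bidding

lemma measurable_stepValue {A : Set (ℝ × ℝ)} (hA : MeasurableSet A) {f G : ℝ → ℝ}
    (hf : Measurable f) (hG : Measurable G) : Measurable (Function.uncurry (stepValue A f G)) := by
  have h1 : Measurable fun q : ℝ × ℝ × ℝ => max (q.1 - q.2.1) 0 := by fun_prop
  have h2 : MeasurableSet {q : ℝ × ℝ × ℝ | 0 < max (q.1 - q.2.1) 0 ∧
      (max (q.1 - q.2.1) 0, q.2.2) ∈ A} :=
    (measurableSet_lt measurable_const h1).inter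
      ((h1.prodMk (by fun_prop : Measurable fun q : ℝ × ℝ × ℝ => q.2.2)) hA)
  exact Measurable.ite h2 (hf.comp (by fun_prop)) (hG.comp h1)

lemma stepValue_neg (A : Set (ℝ × ℝ)) (f G : ℝ → ℝ) (s : ℝ) (z : ℝ × ℝ) :
    stepValue A (fun x => -f x) (fun u => -G u) s z = -stepValue A f G s z := by
  unfold stepValue
  split_ifs <;> rfl

lemma max_sub_mem_Icc {s t d : ℝ} (hs : s ∈ Icc 0 t) (hd : 0 ≤ d) : max (s - d) 0 ∈ Icc 0 t :=
  ⟨le_max_right _ _, max_le (by linarith [hs.2]) (hs.1.trans hs.2)⟩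

lemma abs_stepValue_sub_le {A : Set (ℝ × ℝ)} {f G g : ℝ → ℝ} {t C : ℝ}
    (hGC : ∀ s ∈ Icc 0 t, |G s| ≤ C) (hg0 : ∀ x, 0 ≤ g x)
    (hgA : ∀ u ∈ Icc 0 t, ∀ x, (u, x) ∈ A → |f x| ≤ g x)
    {s : ℝ} (hs : s ∈ Icc 0 t) {z : ℝ × ℝ} (hz : 0 ≤ z.1) :
    |stepValue A f G s z - G s| ≤ g z.2 + 2 * C := by
  have h1 := hGC s hs
  have h2 := max_sub_mem_Icc hs hz
  have h3 := hGC _ h2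
  have h4 := hg0 z.2
  have h5 := abs_nonneg (G s)
  refine (abs_sub _ _).trans ?_
  unfold stepValue
  split_ifs with h
  · linarith [hgA _ h2 _ h.2]
  · linarith

open Classical in
/-- The one-step balance, read off from a differential equation: `K u` is the mean payoff of an
offer that arrives when the time `u` is left, and `G' = lam * (K - G)`. -/
lemma integral_stepValue_sub_eq_zero {lam : ℝ} (hlam : 0 < lam) {ν : Measure ℝ}
    [IsProbabilityMeasure ν] {A : Set (ℝ × ℝ)} (hA : MeasurableSet A) {f G K g : ℝ → ℝ}
    (hf : Measurable f) (hG : Continuous G) {t : ℝ}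
    (hg : Integrable g ν) (hg0 : ∀ x, 0 ≤ g x)
    (hgA : ∀ u ∈ Icc 0 t, ∀ x, (u, x) ∈ A → |f x| ≤ g x)
    (hKA : ∀ u ∈ Ioc 0 t, ∫ x, (if (u, x) ∈ A then f x else G u) ∂ν = K u)
    (hK : IntervalIntegrable K volume 0 t) {c : Set ℝ} (hc : c.Countable)
    (hd : ∀ u ∈ Ioo 0 t \ c, HasDerivAt G (lam * (K u - G u)) u) {s : ℝ} (hs : s ∈ Icc 0 t) :
    ∫ z, (stepValue A f G s z - G s) ∂((expMeasure lam).prod ν) = 0 := by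
  have := isProbabilityMeasure_expMeasure hlam
  obtain ⟨C, hC⟩ := isCompact_Icc.exists_bound_of_continuousOn (hG.continuousOn (s := Icc 0 t))
  have hm : Measurable (stepValue A f G s) :=
    (measurable_stepValue hA hf hG.measurable).comp measurable_prodMk_left
  have hint : Integrable (fun z => stepValue A f G s z - G s) ((expMeasure lam).prod ν) := by
    have hgz : Integrable (fun z : ℝ × ℝ => g z.2 + 2 * C) ((expMeasure lam).prod ν) :=
      (hg.comp_snd (expMeasure lam)).add (integrable_const _)
    refine hgz.mono' (hm.sub_const _).aestronglyMeasurable ?_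
    have hz : ∀ᵐ z ∂((expMeasure lam).prod ν), 0 ≤ z.1 :=
      Measure.quasiMeasurePreserving_fst.ae (ae_expMeasure_nonneg lam)
    filter_upwards [hz] with z hz
    exact abs_stepValue_sub_le hC hg0 hgA hs hz
  have hint' : Integrable (stepValue A f G s) ((expMeasure lam).prod ν) :=
    (hint.add (integrable_const (G s))).congr (.of_forall fun z => by simp)
  rw [integral_sub hint' (integrable_const _), integral_prod _ hint']
  -- the value of `K` at `0` is changed to that of `G`, which does not affect integrals
  set K' : ℝ → ℝ := Function.update K 0 (G 0) with hK'
  have hKK' : ∀ u, u ≠ 0 → K' u = K u := fun u hu => Function.update_of_ne hu _ _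
  have h1 : ∫ d, ∫ x, stepValue A f G s (d, x) ∂ν ∂expMeasure lam =
      ∫ d, K' (max (s - d) 0) ∂expMeasure lam := by
    refine integral_congr_ae ?_
    filter_upwards [ae_expMeasure_nonneg lam] with d hd
    have hu := max_sub_mem_Icc hs hd
    rcases hu.1.eq_or_lt with h0 | h0
    · simp only [stepValue, ← h0]
      simp [hK']
    · simp only [stepValue, h0, true_and]
      rw [hKA _ ⟨h0, hu.2⟩, hKK' _ h0.ne']
  have h2 : IntervalIntegrable K' volume 0 s := by
    refine (hK.mono_set ?_).congr fun u hu => ?_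
    · rw [uIcc_of_le hs.1, uIcc_of_le (hs.1.trans hs.2)]
      exact Icc_subset_Icc_right hs.2
    · rw [uIoc_of_le hs.1] at hu
      exact (hKK' u hu.1.ne').symm
  rw [h1, integral_expMeasure_eq_of_hasDerivAt hlam hs.1 h2 hG.continuousOn (by simp [hK']) hc]
  · simp
  · intro u hu
    rw [hKK' u hu.1.1.ne']
    exact hd u ⟨⟨hu.1.1, hu.1.2.trans_le hs.2⟩, hu.2⟩

open Classical in
/-- The expected payoff of a policy is identified by solving `G' = lam * (K - G)`, where `K u` is
the mean payoff of an offer that arrives when the time `u` is left. -/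
theorem integral_payoff_eq {Ω : Type*} {D X : ℕ → Ω → ℝ} {X₀ : Ω → ℝ} [MeasurableSpace Ω]
    {P : Measure Ω} {lam : ℝ} {ν ν₀ : Measure ℝ} [IsProbabilityMeasure P] [IsProbabilityMeasure ν]
    (hlam : 0 < lam)
    (hproc : IsBiddingProcess P lam ν ν₀ D X X₀)
    (hD : ∀ i, Measurable (D i)) (hX : ∀ i, Measurable (X i)) (hX₀ : Measurable X₀)
    {t : ℝ} (ht : 0 ≤ t) {A : Set (ℝ × ℝ)} (hA : MeasurableSet A) {f G K g : ℝ → ℝ}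
    (hf : Measurable f) (hG : Continuous G)
    (hg : Integrable g ν) (hg0 : ∀ x, 0 ≤ g x)
    (hgA : ∀ u ∈ Icc 0 t, ∀ x, (u, x) ∈ A → |f x| ≤ g x)
    (hKA : ∀ u ∈ Ioc 0 t, ∫ x, (if (u, x) ∈ A then f x else G u) ∂ν = K u)
    (hK : IntervalIntegrable K volume 0 t) {c : Set ℝ} (hc : c.Countable)
    (hd : ∀ u ∈ Ioo 0 t \ c, HasDerivAt G (lam * (K u - G u)) u)
    (hf₀ : Integrable f ν₀) (hfG : ∫ x, f x ∂ν₀ = G 0)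
    (hS : Integrable (fun ω => f (salePrice A (D · ω) (X · ω) (X₀ ω) t)) P) :
    ∫ ω, f (salePrice A (D · ω) (X · ω) (X₀ ω) t) ∂P = G t := by
  obtain ⟨C, hC⟩ := isCompact_Icc.exists_bound_of_continuousOn (hG.continuousOn (s := Icc 0 t))
  have hGm := hG.measurable
  have hmu : Measurable (Function.uncurry fun s z => stepValue A f G s z - G s) :=
    (measurable_stepValue hA hf hGm).sub (hGm.comp measurable_fst)
  have hgi : Integrable (fun x => g x + 2 * C) ν := hg.add (integrable_const _)
  have h0 : ∀ s ∈ Icc 0 t, _ := fun s hs =>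
    integral_stepValue_sub_eq_zero hlam hA hf hG hg hg0 hgA hKA hK hc hd hs
  apply le_antisymm
  · exact integral_payoff_le hlam hproc hD hX hX₀ ht hA hf hGm hC hgi hmu
      (fun s hs z hz => abs_stepValue_sub_le hC hg0 hgA hs hz) (fun s hs => (h0 s hs).le)
      (fun s hs z hz => le_rfl) hf₀ hfG hS
  · have := integral_payoff_le hlam hproc hD hX hX₀ ht hA hf.neg hGm.neg (C := C)
      (fun s hs => by simpa using hC s hs) hgi (B := fun s z => -(stepValue A f G s z - G s))
      hmu.neg (fun s hs z hz => by
        rw [abs_neg]; exact abs_stepValue_sub_le hC hg0 hgA hs hz)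
      (fun s hs => by rw [integral_neg, h0 s hs, neg_zero])
      (fun s hs z hz => by
        have := stepValue_neg A f G s z
        simp only [Pi.neg_def]
        rw [this]
        linarith) hf₀.neg
      (by simp only [Pi.neg_apply]; rw [integral_neg, hfG]) hS.neg
    simp only [Pi.neg_apply] at this
    rw [integral_neg] at this
    linarith

/-! ### The variance as a function of the reservation price -/

lemma integral_ite_le_self {ν : Measure ℝ} [IsProbabilityMeasure ν]
    (h : Integrable (fun x : ℝ => max x 0) ν) (w : ℝ) :
    ∫ x, (if w ≤ x then x else w) ∂ν = w + tailIntegral ν w := by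
  have e : ∀ x : ℝ, (if w ≤ x then x else w) = w + max (x - w) 0 := by
    intro x
    split_ifs with hx
    · rw [max_eq_left (by linarith)]; ring
    · rw [max_eq_right (by linarith)]; ring
  simp_rw [e]
  rw [integral_add (integrable_const _) (integrable_max_sub h w),
    (integrableOn_one_sub_cdf h w).2]
  simp

lemma integral_ite_le_sq {ν : Measure ℝ} [IsProbabilityMeasure ν]
    (h : Integrable (fun x : ℝ => (max x 0) ^ 2) ν) (w q : ℝ) :
    ∫ x, (if w ≤ x then x ^ 2 else q) ∂ν =
      2 * (∫ x in Ioi w, tailIntegral ν x) + 2 * w * tailIntegral ν w +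
        (w ^ 2 - q) * ν.real (Ici w) + q := by
  have h1 := integrable_max_of_sq h
  have e : ∀ x : ℝ, (if w ≤ x then x ^ 2 else q) = (max (x - w) 0) ^ 2 + 2 * w * max (x - w) 0 +
      (Ici w).indicator (fun _ => w ^ 2 - q) x + q := by
    intro x
    by_cases hx : w ≤ x
    · rw [if_pos hx, max_eq_left (by linarith), indicator_of_mem (mem_Ici.2 hx)]; ring
    · rw [if_neg hx, max_eq_right (by linarith), indicator_of_notMem (by simpa using hx)]; ring
  have i1 := integrable_sq_max_sub h w
  have i2 := (integrable_max_sub h1 w).const_mul (2 * w)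
  have i3 : Integrable ((Ici w).indicator (fun _ => w ^ 2 - q)) ν :=
    (integrable_const _).indicator measurableSet_Ici
  have i12 : Integrable (fun x => (max (x - w) 0) ^ 2 + 2 * w * max (x - w) 0) ν := i1.add i2
  have i123 : Integrable (fun x => (max (x - w) 0) ^ 2 + 2 * w * max (x - w) 0 +
      (Ici w).indicator (fun _ => w ^ 2 - q) x) ν := i12.add i3
  simp_rw [e]
  rw [integral_add i123 (integrable_const _), integral_add i12 i3,
    integral_add i1 i2, integral_const_mul, (integrableOn_one_sub_cdf h1 w).2,
    (integrableOn_integral_max_sub h w).2, integral_indicator measurableSet_Ici, setIntegral_const]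
  simp
  ring

lemma continuous_integral_Ioi_tailIntegral {ν : Measure ℝ} [IsProbabilityMeasure ν]
    (h : Integrable (fun x : ℝ => (max x 0) ^ 2) ν) :
    Continuous fun w => ∫ x in Ioi w, tailIntegral ν x := by
  have hc := continuous_tailIntegral (integrable_max_of_sq h)
  have : (fun w => ∫ x in Ioi w, tailIntegral ν x) =
      fun w => (∫ x in Ioi 0, tailIntegral ν x) - ∫ x in (0 : ℝ)..w, tailIntegral ν x := by
    ext w
    rw [← intervalIntegral.integral_Ioi_sub_Ioi' (integrableOn_integral_max_sub h 0).1
      (integrableOn_integral_max_sub h w).1]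
    ring
  rw [this]
  exact continuous_const.sub
    (intervalIntegral.continuous_primitive (fun a b => hc.intervalIntegrable a b) 0)

/-- The variance of the sale price when the reservation price has reached the level `w`, with a
residual price of mean `a` and variance `v`. -/
noncomputable def priceVariance (ν : Measure ℝ) (a v w : ℝ) : ℝ :=
  tailIntegral ν w * (v / tailIntegral ν a +
    2 * ∫ y in a..w, (1 / tailIntegral ν y ^ 2) * ∫ x in Ioi y, tailIntegral ν x)

lemma tailIntegral_pos_of_mem_uIcc {ν : Measure ℝ} [IsProbabilityMeasure ν]
    (h : Integrable (fun x : ℝ => (max x 0) ^ 2) ν) {a w : ℝ}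
    (ha : 0 < tailIntegral ν a) (hw : 0 < tailIntegral ν w) {y : ℝ} (hy : y ∈ uIcc a w) :
    0 < tailIntegral ν y := by
  have hanti := antitone_tailIntegral (integrable_max_of_sq h)
  refine (lt_min ha hw).trans_le ?_
  rw [← hanti.map_max]
  exact hanti hy.2

lemma intervalIntegrable_priceVariance {ν : Measure ℝ} [IsProbabilityMeasure ν]
    (h : Integrable (fun x : ℝ => (max x 0) ^ 2) ν) {a w : ℝ}
    (ha : 0 < tailIntegral ν a) (hw : 0 < tailIntegral ν w) :
    IntervalIntegrable (fun y => (1 / tailIntegral ν y ^ 2) * ∫ x in Ioi y, tailIntegral ν x)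
      volume a w := by
  refine ContinuousOn.intervalIntegrable (ContinuousOn.mul (continuousOn_const.div
    ((continuous_tailIntegral (integrable_max_of_sq h)).pow 2).continuousOn fun y hy => ?_)
    (continuous_integral_Ioi_tailIntegral h).continuousOn)
  exact (pow_pos (tailIntegral_pos_of_mem_uIcc h ha hw hy) 2).ne'

lemma hasDerivAt_integral_div_sq {ν : Measure ℝ} [IsProbabilityMeasure ν]
    (h : Integrable (fun x : ℝ => (max x 0) ^ 2) ν) {a w : ℝ}
    (ha : 0 < tailIntegral ν a) (hw : 0 < tailIntegral ν w) :
    HasDerivAt (fun w => ∫ y in a..w, (1 / tailIntegral ν y ^ 2) * ∫ x in Ioi y, tailIntegral ν x)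
      ((1 / tailIntegral ν w ^ 2) * ∫ x in Ioi w, tailIntegral ν x) w := by
  have hc := continuous_tailIntegral (integrable_max_of_sq h)
  have hc2 := continuous_integral_Ioi_tailIntegral h
  refine intervalIntegral.integral_hasDerivAt_right (intervalIntegrable_priceVariance h ha hw) ?_ ?_
  · exact ((measurable_const.div (hc.measurable.pow_const 2)).mul
      hc2.measurable).stronglyMeasurable.stronglyMeasurableAtFilter
  · exact (continuousAt_const.div (hc.pow 2).continuousAt (pow_pos hw 2).ne').mul hc2.continuousAt

lemma continuousAt_priceVariance {ν : Measure ℝ} [IsProbabilityMeasure ν]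
    (h : Integrable (fun x : ℝ => (max x 0) ^ 2) ν) {a w : ℝ} (v : ℝ)
    (ha : 0 < tailIntegral ν a) (hw : 0 < tailIntegral ν w) :
    ContinuousAt (priceVariance ν a v) w :=
  (continuous_tailIntegral (integrable_max_of_sq h)).continuousAt.mul
    (continuousAt_const.add
      (continuousAt_const.mul (hasDerivAt_integral_div_sq h ha hw).continuousAt))

/-- The linear differential equation of the variance; `-(1 - F(w))` is the slope of the
tail integral, which is differentiable off the atoms of the offer distribution only. -/
lemma hasDerivAt_priceVariance {ν : Measure ℝ} [IsProbabilityMeasure ν]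
    (h : Integrable (fun x : ℝ => (max x 0) ^ 2) ν) {a w : ℝ} (v : ℝ)
    (ha : 0 < tailIntegral ν a) (hw : 0 < tailIntegral ν w) (hcont : ContinuousAt (cdf ν) w) :
    HasDerivAt (priceVariance ν a v)
      ((2 * (∫ x in Ioi w, tailIntegral ν x) - (1 - cdf ν w) * priceVariance ν a v w) /
        tailIntegral ν w) w := by
  have h1 := hasDerivAt_tailIntegral (integrable_max_of_sq h) hcont
  have h2 := ((hasDerivAt_integral_div_sq h ha hw).const_mul 2).const_add (v / tailIntegral ν a)
  refine (h1.mul h2).congr_deriv ?_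
  have := hw.ne'
  unfold priceVariance
  field_simp
  ring

lemma priceVariance_self {ν : Measure ℝ} {a : ℝ} (v : ℝ) (ha : 0 < tailIntegral ν a) :
    priceVariance ν a v a = v := by
  simp [priceVariance, mul_div_cancel₀ _ ha.ne']

/-- Integrating `φ` twice gives half of `E[(X - y)₊ ^ 2]`, which turns one form of the
variance formula into the other. -/
lemma one_div_sq_mul_integral_eq {ν : Measure ℝ} [IsProbabilityMeasure ν]
    (h : Integrable (fun x : ℝ => (max x 0) ^ 2) ν) {y : ℝ}
    (hy : 0 < tailIntegral ν y) :
    Var[fun x : ℝ => max (x - y) 0; ν] / (∫ x, max (x - y) 0 ∂ν) ^ 2 =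
      2 * ((1 / tailIntegral ν y ^ 2) * ∫ x in Ioi y, tailIntegral ν x) - 1 := by
  have hLp : MemLp (fun x : ℝ => max (x - y) 0) 2 ν :=
    (memLp_two_iff_integrable_sq (by fun_prop)).2 (integrable_sq_max_sub h y)
  rw [variance_eq_sub hLp, (integrableOn_integral_max_sub h y).2,
    ← (integrableOn_one_sub_cdf (integrable_max_of_sq h) y).2]
  have := hy.ne'
  simp only [Pi.pow_apply]
  field_simp

lemma intervalIntegrable_variance_div {ν : Measure ℝ} [IsProbabilityMeasure ν]
    (h : Integrable (fun x : ℝ => (max x 0) ^ 2) ν) {a w : ℝ}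
    (ha : 0 < tailIntegral ν a) (hw : 0 < tailIntegral ν w) :
    IntervalIntegrable (fun y => Var[fun x : ℝ => max (x - y) 0; ν] /
      (∫ x, max (x - y) 0 ∂ν) ^ 2) volume a w ∧
    ∫ y in a..w, Var[fun x : ℝ => max (x - y) 0; ν] / (∫ x, max (x - y) 0 ∂ν) ^ 2 =
      2 * (∫ y in a..w, (1 / tailIntegral ν y ^ 2) * ∫ x in Ioi y, tailIntegral ν x) - (w - a) := by
  have hi := intervalIntegrable_priceVariance h ha hw
  have e : EqOn (fun y => 2 * ((1 / tailIntegral ν y ^ 2) * ∫ x in Ioi y, tailIntegral ν x) - 1)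
      (fun y => Var[fun x : ℝ => max (x - y) 0; ν] / (∫ x, max (x - y) 0 ∂ν) ^ 2) (uIcc a w) :=
    fun y hy => (one_div_sq_mul_integral_eq h (tailIntegral_pos_of_mem_uIcc h ha hw hy)).symm
  constructor
  · exact ((hi.const_mul 2).sub intervalIntegrable_const).congr
      (e.mono uIoc_subset_uIcc)
  · rw [← intervalIntegral.integral_congr e, intervalIntegral.integral_sub (hi.const_mul 2)
      intervalIntegrable_const, intervalIntegral.integral_const_mul]
    simp

/-! ### The threshold policy -/

/-- The policy that accepts the offer `x` at the remaining time `s` if `m s ≤ x`; negative times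
are treated like `0`. -/
def thresholdPolicy (m : ℝ → ℝ) : Set (ℝ × ℝ) := {p | m (max p.1 0) ≤ p.2}

lemma measurableSet_thresholdPolicy {m : ℝ → ℝ} (hm : Continuous m) :
    MeasurableSet (thresholdPolicy m) :=
  measurableSet_le (by fun_prop) measurable_snd

section Bidding

variable {Ω : Type*} {D X : ℕ → Ω → ℝ} {X₀ : Ω → ℝ} [MeasurableSpace Ω] {P : Measure Ω}
  {lam : ℝ} {ν ν₀ : Measure ℝ}

/-- Without time there are no offers. -/
lemma salePrice_ae_eq_residual (hproc : IsBiddingProcess P lam ν ν₀ D X X₀) {t : ℝ} (ht : t ≤ 0)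
    (A : Set (ℝ × ℝ)) : (fun ω => salePrice A (D · ω) (X · ω) (X₀ ω) t) =ᵐ[P] X₀ := by
  filter_upwards [ae_wait_nonneg hproc] with ω hω
  have h0 : ∀ n, timeLeft (D · ω) t n ≤ 0 := by
    intro n
    induction n with
    | zero => exact ht
    | succ n ih => exact max_le (by linarith [hω n]) le_rfl
  exact salePrice_eq_residual fun i hi => absurd hi.1 (not_lt.2 (h0 _))

lemma integral_residual (hproc : IsBiddingProcess P lam ν ν₀ D X X₀) {f : ℝ → ℝ}
    (hf : Measurable f) : ∫ ω, f (X₀ ω) ∂P = ∫ x, f x ∂ν₀ := by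
  rw [← hproc.hasLaw_residual.map_eq,
    integral_map hproc.hasLaw_residual.aemeasurable hf.aestronglyMeasurable]

lemma expectedPrices_of_nonpos [IsProbabilityMeasure P] [IsProbabilityMeasure ν₀]
    (hproc : IsBiddingProcess P lam ν ν₀ D X X₀) (h₀ : Integrable (fun x : ℝ => x) ν₀)
    {t : ℝ} (ht : t ≤ 0) : expectedPrices P D X X₀ t = {∫ x, x ∂ν₀} := by
  have hX₀ : Integrable X₀ P := by
    rw [← hproc.hasLaw_residual.map_eq] at h₀
    exact h₀.comp_aemeasurable hproc.hasLaw_residual.aemeasurable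
  ext v
  simp only [expectedPrices, mem_ofPred_eq, mem_singleton_iff]
  constructor
  · rintro ⟨A, -, -, rfl⟩
    rw [integral_congr_ae (salePrice_ae_eq_residual hproc ht A)]
    exact integral_residual hproc measurable_id
  · rintro rfl
    refine ⟨∅, MeasurableSet.empty, hX₀.congr (salePrice_ae_eq_residual hproc ht ∅).symm, ?_⟩
    rw [integral_congr_ae (salePrice_ae_eq_residual hproc ht ∅)]
    exact (integral_residual hproc measurable_id).symm

/-- The moments of the sale price under the threshold policy whose threshold `m` solves
`m' = lam * φ(m)`, and the comparison with the other policies. -/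
lemma thresholdPolicy_moments [IsProbabilityMeasure P] [IsProbabilityMeasure ν]
    [IsProbabilityMeasure ν₀] (hlam : 0 < lam)
    (hproc : IsBiddingProcess P lam ν ν₀ D X X₀)
    (hD : ∀ i, Measurable (D i)) (hX : ∀ i, Measurable (X i)) (hX₀ : Measurable X₀)
    (h₀ : Integrable (fun x : ℝ => x ^ 2) ν₀) (h : Integrable (fun x : ℝ => (max x 0) ^ 2) ν)
    (hnonneg : 0 ≤ ∫ x, x ∂ν₀) {m : ℝ → ℝ} (hmono : StrictMono m) (hmc : Continuous m)
    (hm0 : m 0 = ∫ x, x ∂ν₀) (hpos : ∀ s, 0 < tailIntegral ν (m s))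
    (hode : ∀ s, 0 < s → HasDerivAt m (lam * tailIntegral ν (m s)) s) {t : ℝ} (ht : 0 ≤ t) :
    MemLp (fun ω => salePrice (thresholdPolicy m) (D · ω) (X · ω) (X₀ ω) t) 2 P ∧
    ∫ ω, salePrice (thresholdPolicy m) (D · ω) (X · ω) (X₀ ω) t ∂P = m t ∧
    (∫ ω, salePrice (thresholdPolicy m) (D · ω) (X · ω) (X₀ ω) t ^ 2 ∂P =
      priceVariance ν (m 0) Var[X₀; P] (m t) + m t ^ 2) ∧
    ∀ A, MeasurableSet A →
      Integrable (fun ω => salePrice A (D · ω) (X · ω) (X₀ ω) t) P →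
      ∫ ω, salePrice A (D · ω) (X · ω) (X₀ ω) t ∂P ≤ m t := by
  classical
  set A₀ := thresholdPolicy m with hA₀
  have hA₀m : MeasurableSet A₀ := measurableSet_thresholdPolicy hmc
  have hmax := integrable_max_of_sq h
  have hA₀0 : ∀ p ∈ A₀, 0 ≤ p.2 := fun p hp =>
    (hnonneg.trans (hm0.symm.le.trans (hmono.monotone (le_max_right _ _)))).trans hp
  have hmem : ∀ u, 0 ≤ u → ∀ x, (u, x) ∈ A₀ ↔ m u ≤ x := fun u hu x => by
    simp only [hA₀, thresholdPolicy, mem_ofPred_eq, max_eq_left hu]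
  have hLp := memLp_salePrice hlam hproc hD hX hX₀ h₀ h hA₀m hA₀0 ht
  have h₀1 : Integrable (fun x : ℝ => x) ν₀ :=
    ((memLp_two_iff_integrable_sq aestronglyMeasurable_id).2 h₀).integrable (by norm_num)
  have hφc := continuous_tailIntegral hmax
  -- data for the mean: the payoff of an offer at the time `u` has mean `m u + φ(m u)`
  have hg1 : ∀ u ∈ Icc 0 t, ∀ x, (u, x) ∈ A₀ → |x| ≤ max x 0 := fun u _ x hx => by
    have : 0 ≤ x := hA₀0 _ hx
    rw [abs_of_nonneg this, max_eq_left this]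
  have hK1 : ∀ u ∈ Ioc 0 t, ∫ x, (if (u, x) ∈ A₀ then x else m u) ∂ν =
      m u + tailIntegral ν (m u) := fun u hu => by
    simp_rw [hmem u hu.1.le]
    exact integral_ite_le_self hmax (m u)
  have hK1i : IntervalIntegrable (fun u => m u + tailIntegral ν (m u)) volume 0 t :=
    (hmc.add (hφc.comp hmc)).intervalIntegrable _ _
  have hd1 : ∀ u ∈ Ioo 0 t \ ∅,
      HasDerivAt m (lam * (m u + tailIntegral ν (m u) - m u)) u := fun u hu => by
    rw [add_sub_cancel_left]
    exact hode u hu.1.1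
  refine ⟨hLp, ?_, ?_, ?_⟩
  · exact integral_payoff_eq hlam hproc hD hX hX₀ ht hA₀m (f := fun x => x) measurable_id hmc hmax
      (fun x => le_max_right _ _) hg1 hK1 hK1i countable_empty hd1 h₀1 hm0.symm
      (hLp.integrable (by norm_num))
  · set v := Var[X₀; P] with hv
    set Q : ℝ → ℝ := fun s => priceVariance ν (m 0) v (m s) + m s ^ 2 with hQ
    have hQc : Continuous Q := by
      refine Continuous.add ?_ (hmc.pow 2)
      exact continuous_iff_continuousAt.2 fun s =>
        (continuousAt_priceVariance h v (hpos 0) (hpos s)).comp hmc.continuousAt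
    set K : ℝ → ℝ := fun u => 2 * (∫ x in Ioi (m u), tailIntegral ν x) +
      2 * m u * tailIntegral ν (m u) + (m u ^ 2 - Q u) * ν.real (Ici (m u)) + Q u with hK
    have hKi : IntervalIntegrable K volume 0 t := by
      have hp : IntervalIntegrable (fun u => ν.real (Ici (m u))) volume 0 t := by
        refine Antitone.intervalIntegrable fun a b hab => ?_
        exact measureReal_mono (Ici_subset_Ici.2 (hmono.monotone hab))
      have c1 : Continuous fun u => 2 * (∫ x in Ioi (m u), tailIntegral ν x) +
          2 * m u * tailIntegral ν (m u) :=
        (continuous_const.mul ((continuous_integral_Ioi_tailIntegral h).comp hmc)).add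
          ((continuous_const.mul hmc).mul (hφc.comp hmc))
      exact ((c1.intervalIntegrable _ _).add
        (hp.continuousOn_mul ((hmc.pow 2).sub hQc).continuousOn)).add (hQc.intervalIntegrable _ _)
    have hc : (m ⁻¹' {w | ¬ ContinuousAt (cdf ν) w}).Countable :=
      (monotone_cdf ν).countable_not_continuousAt.preimage hmono.injective
    refine integral_payoff_eq hlam hproc hD hX hX₀ ht hA₀m (f := fun x => x ^ 2) (G := Q) (K := K)
      (measurable_id.pow_const 2) hQc h (fun x => by positivity) ?_ ?_ hKi hc ?_ h₀ ?_
      hLp.integrable_sq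
    · intro u hu x hx
      have := hg1 u hu x hx
      rw [abs_pow]
      gcongr
    · intro u hu
      simp_rw [hmem u hu.1.le]
      exact integral_ite_le_sq h (m u) (Q u)
    · rintro u ⟨hu, hcu⟩
      have hcu : ContinuousAt (cdf ν) (m u) := by simpa using hcu
      have hmu := hode u hu.1
      have h1 := ((hasDerivAt_priceVariance h v (hpos 0) (hpos u) hcu).comp u hmu).add (hmu.pow 2)
      refine h1.congr_deriv ?_
      have := (hpos u).ne'
      simp only [hK, hQ]
      rw [measureReal_Ici_eq_of_continuousAt_cdf hcu]
      field_simp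
      push_cast
      ring
    · have hX₀Lp : MemLp X₀ 2 P := by
        rw [memLp_two_iff_integrable_sq hX₀.aestronglyMeasurable]
        rw [← hproc.hasLaw_residual.map_eq] at h₀
        exact h₀.comp_measurable hX₀
      simp only [hQ]
      rw [priceVariance_self v (hpos 0), hv, variance_eq_sub hX₀Lp, hm0]
      have e1 := integral_residual hproc (f := fun x => x ^ 2) (measurable_id.pow_const 2)
      have e2 := integral_residual hproc (f := fun x => x) measurable_id
      simp only [Pi.pow_apply]
      rw [e1, e2]
      ring
  · intro A hA hS
    obtain ⟨C, hC⟩ := isCompact_Icc.exists_bound_of_continuousOn (hmc.continuousOn (s := Icc 0 t))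
    refine integral_payoff_le hlam hproc hD hX hX₀ ht hA (f := fun x => x) (G := m)
      (g := fun x => max x 0 + 2 * C) (B := fun s z => stepValue A₀ (fun x => x) m s z - m s)
      measurable_id hmc.measurable hC (hmax.add (integrable_const _))
      ((measurable_stepValue hA₀m measurable_id hmc.measurable).sub
        (hmc.measurable.comp measurable_fst))
      (fun s hs z hz => abs_stepValue_sub_le hC (fun x => le_max_right x 0) hg1 hs hz)
      (fun s hs => (integral_stepValue_sub_eq_zero hlam hA₀m measurable_id hmc hmax
        (fun x => le_max_right _ _) hg1 hK1 hK1i countable_empty hd1 hs).le) ?_ h₀1 hm0.symm hS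
    -- the threshold policy takes the larger one of the offer and the continuation value
    intro s hs z hz
    refine sub_le_sub_right ?_ _
    have hu := le_max_right (s - z.1) 0
    simp only [stepValue, hmem _ hu]
    split_ifs with h1 h2 h2
    · exact le_rfl
    · exact (not_le.1 fun h3 => h2 ⟨h1.1, h3⟩).le
    · exact h2.2
    · exact le_rfl

/-- The function `m` of the threshold policy is the optimal value, and the threshold policy is the
optimal policy. -/
lemma optimalValue_eq [IsProbabilityMeasure P] [IsProbabilityMeasure ν]
    [IsProbabilityMeasure ν₀] (hlam : 0 < lam)
    (hproc : IsBiddingProcess P lam ν ν₀ D X X₀)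
    (hD : ∀ i, Measurable (D i)) (hX : ∀ i, Measurable (X i)) (hX₀ : Measurable X₀)
    (h₀ : Integrable (fun x : ℝ => x ^ 2) ν₀) (h : Integrable (fun x : ℝ => (max x 0) ^ 2) ν)
    (hnonneg : 0 ≤ ∫ x, x ∂ν₀) {m : ℝ → ℝ} (hmono : StrictMono m) (hmc : Continuous m)
    (hm0 : m 0 = ∫ x, x ∂ν₀) (hpos : ∀ s, 0 < tailIntegral ν (m s))
    (hode : ∀ s, 0 < s → HasDerivAt m (lam * tailIntegral ν (m s)) s) :
    (∀ t, 0 ≤ t → IsGreatest (expectedPrices P D X X₀ t) (m t)) ∧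
    optimalValue P D X X₀ = (fun s => m (max s 0)) ∧
    optimalPolicy P D X X₀ = thresholdPolicy m := by
  have h1 : ∀ t, 0 ≤ t → IsGreatest (expectedPrices P D X X₀ t) (m t) := by
    intro t ht
    obtain ⟨hLp, hmean, -, hle⟩ := thresholdPolicy_moments hlam hproc hD hX hX₀ h₀ h hnonneg hmono
      hmc hm0 hpos hode ht
    refine ⟨⟨thresholdPolicy m, measurableSet_thresholdPolicy hmc,
      hLp.integrable (by norm_num), hmean.symm⟩, ?_⟩
    rintro _ ⟨A, hA, hS, rfl⟩
    exact hle A hA hS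
  have h2 : optimalValue P D X X₀ = fun s => m (max s 0) := by
    ext s
    rcases le_total 0 s with hs | hs
    · rw [max_eq_left hs]
      exact (h1 s hs).csSup_eq
    · have h₀1 : Integrable (fun x : ℝ => x) ν₀ :=
        ((memLp_two_iff_integrable_sq aestronglyMeasurable_id).2 h₀).integrable (by norm_num)
      rw [max_eq_right hs, hm0, optimalValue, expectedPrices_of_nonpos hproc h₀1 hs,
        csSup_singleton]
  exact ⟨h1, h2, by rw [optimalPolicy, h2]; rfl⟩

/-! ### Modification on null sets -/

/-- The bidding process may be replaced by one of measurable (not just a.e. measurable) random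
variables that agrees with it almost surely. -/
lemma IsBiddingProcess.exists_measurable (hproc : IsBiddingProcess P lam ν ν₀ D X X₀) :
    ∃ (D' X' : ℕ → Ω → ℝ) (X₀' : Ω → ℝ), (∀ i, Measurable (D' i)) ∧ (∀ i, Measurable (X' i)) ∧
      Measurable X₀' ∧ IsBiddingProcess P lam ν ν₀ D' X' X₀' ∧ X₀ =ᵐ[P] X₀' ∧
      ∀ A t, (fun ω => salePrice A (D · ω) (X · ω) (X₀ ω) t) =ᵐ[P]
        fun ω => salePrice A (D' · ω) (X' · ω) (X₀' ω) t := by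
  have hD := fun i => (hproc.hasLaw_wait i).aemeasurable
  have hX := fun i => (hproc.hasLaw_offer i).aemeasurable
  have hX₀ := hproc.hasLaw_residual.aemeasurable
  refine ⟨fun i => (hD i).mk, fun i => (hX i).mk, hX₀.mk, fun i => (hD i).measurable_mk,
    fun i => (hX i).measurable_mk, hX₀.measurable_mk, ?_, hX₀.ae_eq_mk, ?_⟩
  · refine ⟨fun i => (hproc.hasLaw_wait i).congr (hD i).ae_eq_mk.symm,
      fun i => (hproc.hasLaw_offer i).congr (hX i).ae_eq_mk.symm,
      hproc.hasLaw_residual.congr hX₀.ae_eq_mk.symm, hproc.indep.congr ?_⟩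
    rintro (i | i | _)
    · exact (hD i).ae_eq_mk
    · exact (hX i).ae_eq_mk
    · exact hX₀.ae_eq_mk
  · intro A t
    filter_upwards [ae_all_iff.2 fun i => (hD i).ae_eq_mk, ae_all_iff.2 fun i => (hX i).ae_eq_mk,
      hX₀.ae_eq_mk] with ω h1 h2 h3
    simp only [h1, h2, h3]

lemma expectedPrices_congr {D' X' : ℕ → Ω → ℝ} {X₀' : Ω → ℝ}
    (h : ∀ A t, (fun ω => salePrice A (D · ω) (X · ω) (X₀ ω) t) =ᵐ[P]
        fun ω => salePrice A (D' · ω) (X' · ω) (X₀' ω) t) :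
    expectedPrices P D X X₀ = expectedPrices P D' X' X₀' := by
  ext t v
  simp only [expectedPrices, mem_ofPred_eq, integral_congr_ae (h _ t), integrable_congr (h _ t)]

end Bidding

/-! ### The variance formula -/

theorem mainTheorem5 {Ω : Type*} [MeasurableSpace Ω] (P : Measure Ω) [IsProbabilityMeasure P]
    (lam : ℝ) (hlam : 0 < lam)
    (ν ν₀ : Measure ℝ) [IsProbabilityMeasure ν] [IsProbabilityMeasure ν₀]
    (D X : ℕ → Ω → ℝ) (X₀ : Ω → ℝ) (hproc : IsBiddingProcess P lam ν ν₀ D X X₀)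
    (hX₀ : Integrable (fun x : ℝ => x ^ 2) ν₀)
    (hX : Integrable (fun x : ℝ => (max x 0) ^ 2) ν)
    (μ₀ : ℝ) (hμ₀ : μ₀ = ∫ x, x ∂ν₀) (hμ₀_nonneg : 0 ≤ μ₀) (hμ₀_lt : (μ₀ : EReal) < supportSup ν)
    (μ : ℝ → ℝ) (hμ : μ = optimalValue P D X X₀)
    (φ : ℝ → ℝ) (hφ : φ = tailIntegral ν)
    (t : ℝ) (ht : 0 ≤ t) :
    -- the threshold policy is optimal, with expected sale price `μ(t)`
    (MeasurableSet (optimalPolicy P D X X₀) ∧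
      IsGreatest (expectedPrices P D X X₀ t) (∫ ω, optimalPrice P D X X₀ t ω ∂P) ∧
      ∫ ω, optimalPrice P D X X₀ t ω ∂P = μ t) ∧
    -- the variance of the sale price is finite
    MemLp (optimalPrice P D X X₀ t) 2 P ∧
    -- the expressions below are well defined
    (μ₀ ≤ μ t ∧
      (∀ w ∈ Icc μ₀ (μ t), IntegrableOn (fun u => 1 - cdf ν u) (Ioi w) ∧ IntegrableOn φ (Ioi w) ∧
        0 < φ w ∧ φ w = ∫ x, max (x - w) 0 ∂ν ∧ MemLp (fun x : ℝ => max (x - w) 0) 2 ν) ∧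
      IntervalIntegrable (fun w => (1 / φ w ^ 2) * ∫ x in Ioi w, φ x) volume μ₀ (μ t) ∧
      IntervalIntegrable (fun w => Var[fun x : ℝ => max (x - w) 0; ν] /
        (∫ x, max (x - w) 0 ∂ν) ^ 2) volume μ₀ (μ t)) ∧
    -- the two formulas for the variance
    Var[optimalPrice P D X X₀ t; P] =
      φ (μ t) * (Var[X₀; P] / φ μ₀ +
        2 * ∫ w in μ₀..(μ t), (1 / φ w ^ 2) * ∫ x in Ioi w, φ x) ∧
    Var[optimalPrice P D X X₀ t; P] =
      (∫ x, max (x - μ t) 0 ∂ν) *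
        (μ t - μ₀ + Var[X₀; P] / (∫ x, max (x - μ₀) 0 ∂ν) +
          ∫ w in μ₀..(μ t), Var[fun x : ℝ => max (x - w) 0; ν] /
            (∫ x, max (x - w) 0 ∂ν) ^ 2) := by
  subst hμ hφ hμ₀
  have hmax := integrable_max_of_sq hX
  have hφ₀ := tailIntegral_pos_of_lt_supportSup hmax hμ₀_lt
  obtain ⟨m, hmono, hmc, hm0, hpos, hode⟩ := exists_hasDerivAt_eq_mul_comp
    (continuous_tailIntegral hmax) (antitone_tailIntegral hmax)
    (fun x y hxy => tailIntegral_sub_le hmax hxy) (tendsto_tailIntegral_atTop hmax) hφ₀ hlam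
  obtain ⟨D', X', X₀', hD', hX', hX₀', hproc', hX₀eq, hsale⟩ := hproc.exists_measurable
  have hprices := expectedPrices_congr hsale
  have hvalue : optimalValue P D X X₀ = optimalValue P D' X' X₀' := by
    ext s
    simp only [optimalValue, hprices]
  have hpolicy : optimalPolicy P D X X₀ = optimalPolicy P D' X' X₀' := by
    simp only [optimalPolicy, hvalue]
  obtain ⟨hgreatest, hv, hp⟩ := optimalValue_eq hlam hproc' hD' hX' hX₀' hX₀ hX hμ₀_nonneg hmono
    hmc hm0 hpos hode
  obtain ⟨hLp, hmean, hsq, -⟩ := thresholdPolicy_moments hlam hproc' hD' hX' hX₀' hX₀ hX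
    hμ₀_nonneg hmono hmc hm0 hpos hode ht
  have hprice : optimalPrice P D X X₀ t =ᵐ[P]
      fun ω => salePrice (thresholdPolicy m) (D' · ω) (X' · ω) (X₀' ω) t := by
    have := hsale (thresholdPolicy m) t
    rwa [← hp, ← hpolicy] at this ⊢
  have hμt : optimalValue P D X X₀ t = m t := by
    rw [hvalue, hv]
    simp only [max_eq_left ht]
  have hvar₀ : Var[X₀'; P] = Var[X₀; P] := variance_congr hX₀eq.symm
  have hmean' : ∫ ω, optimalPrice P D X X₀ t ω ∂P = m t := (integral_congr_ae hprice).trans hmean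
  have hvar : Var[optimalPrice P D X X₀ t; P] =
      priceVariance ν (∫ x, x ∂ν₀) Var[X₀; P] (m t) := by
    rw [variance_congr hprice, variance_eq_sub hLp, hmean, ← hvar₀, ← hm0]
    simp only [Pi.pow_apply]
    rw [hsq]
    ring
  have hle : ∫ x, x ∂ν₀ ≤ m t := hm0 ▸ hmono.monotone ht
  have hφpos : ∀ w ∈ Icc (∫ x, x ∂ν₀) (m t), 0 < tailIntegral ν w := fun w hw =>
    (hpos t).trans_le (antitone_tailIntegral hmax hw.2)
  have hvd := intervalIntegrable_variance_div hX hφ₀ (hpos t)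
  rw [hμt]
  refine ⟨⟨?_, ?_, hmean'⟩, (memLp_congr_ae hprice).2 hLp, ⟨hle, fun w hw => ?_,
    intervalIntegrable_priceVariance hX hφ₀ (hpos t), hvd.1⟩, hvar, ?_⟩
  · rw [hpolicy, hp]
    exact measurableSet_thresholdPolicy hmc
  · rw [hprices, hmean']
    exact hgreatest t ht
  · exact ⟨(integrableOn_one_sub_cdf hmax w).1, (integrableOn_integral_max_sub hX w).1, hφpos w hw,
      (integrableOn_one_sub_cdf hmax w).2,
      (memLp_two_iff_integrable_sq (by fun_prop)).2 (integrable_sq_max_sub hX w)⟩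
  · rw [hvar, hvd.2, priceVariance, (integrableOn_one_sub_cdf hmax (m t)).2,
      (integrableOn_one_sub_cdf hmax (∫ x, x ∂ν₀)).2]
    ring
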